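/- Let $G$ be a finite group, and for $X\subseteq G$ write $\overline X=\sum_{x\in X}x\in\mathbb CG$ and $X^{-1}=\{x^{-1}:x\in X\}$. A Schur ring (S-ring) over $G$ is given by a partition $\{\Gamma_1,\dots,\Gamma_m\}$ of $G$ into non-empty sets, called its principal sets, with $\Gamma_1=\{1\}$, such that each $\Gamma_i^{-1}$ is some $\Gamma_j$, and such that for all $i,j$ one has $\overline{\Gamma}_i\,\overline{\Gamma}_j=\sum_{k=1}^m\lambda_{ijk}\overline{\Gamma}_k$ with integers $\lambda_{ijk}\ge 0$. The S-ring itself is the subalgebra of $\mathbb CG$ spanned by $\overline\Gamma_1,\dots,\overline\Gamma_m$, and it is called commutative if this subalgebra is a commutative ring. Proposition. Let $\mathfrak S$ be a commutative S-ring over the symmetric group $S_6$ such that the set $\mathcal C_2$ of all transpositions is a principal set of $\mathfrak S$. Then the set $\mathcal C_3$ of all $3$-cycles is also a principal set of $\mathfrak S$. -/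

import Mathlib

/-- The element `X̄ = ∑_{x ∈ X} x` of the group algebra `ℂG`. -/
noncomputable def groupSum {G : Type*} (X : Finset G) : MonoidAlgebra ℂ G :=
  ∑ x ∈ X, MonoidAlgebra.single x (1 : ℂ)

/-- A Schur ring (S-ring) over a finite group `G`, given by its partition of `G`. -/
structure SchurRing (G : Type*) [Group G] [Fintype G] [DecidableEq G] where
  /-- the partition of `G` into nonempty sets, the principal sets -/
  partition : Finpartition (Finset.univ : Finset G)
  singleton_one_mem : {1} ∈ partition.parts
  inv_mem : ∀ A ∈ partition.parts, A.image (fun g => g⁻¹) ∈ partition.parts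
  mul_eq : ∀ A ∈ partition.parts, ∀ B ∈ partition.parts, ∃ l : Finset G → ℕ,
    groupSum A * groupSum B = ∑ C ∈ partition.parts, (l C : ℂ) • groupSum C

namespace SchurRing

/-- The subset `X` of `G` is a principal set of the S-ring. -/
def IsPrincipalSet {G : Type*} [Group G] [Fintype G] [DecidableEq G]
    (S : SchurRing G) (X : Set G) : Prop :=
  ∃ A ∈ S.partition.parts, (A : Set G) = X

/-- The set of the sums `Ā`, where `A` is a principal set. -/
def basis {G : Type*} [Group G] [Fintype G] [DecidableEq G]
    (S : SchurRing G) : Set (MonoidAlgebra ℂ G) :=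
  groupSum '' (S.partition.parts : Set (Finset G))

/-- The S-ring as a subalgebra of `ℂG`: the linear span of the sums over its principal sets. -/
noncomputable def toSubalgebra {G : Type*} [Group G] [Fintype G] [DecidableEq G]
    (S : SchurRing G) : Subalgebra ℂ (MonoidAlgebra ℂ G) :=
  (Submodule.span ℂ S.basis).toSubalgebra
    (Submodule.subset_span ⟨{1}, S.singleton_one_mem, by
      simp [groupSum, MonoidAlgebra.one_def]⟩)
    (by
      intro x y hx hy
      have h : x * y ∈ Submodule.span ℂ S.basis * Submodule.span ℂ S.basis :=
        Submodule.mul_mem_mul hx hy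
      rw [Submodule.span_mul_span] at h
      refine (Submodule.span_le.2 ?_) h
      rintro _ ⟨_, ⟨A, hA, rfl⟩, _, ⟨B, hB, rfl⟩, rfl⟩
      obtain ⟨l, hl⟩ := S.mul_eq A hA B hB
      simp only [hl]
      exact Submodule.sum_mem _ fun C hC =>
        Submodule.smul_mem _ _ (Submodule.subset_span ⟨C, hC, rfl⟩))

/-- The S-ring is a commutative ring. -/
def IsCommutative {G : Type*} [Group G] [Fintype G] [DecidableEq G]
    (S : SchurRing G) : Prop :=
  ∀ x ∈ S.toSubalgebra, ∀ y ∈ S.toSubalgebra, x * y = y * x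

end SchurRing

/-! ### Convolution, and families of functions closed under it -/

open Equiv Equiv.Perm

/-! The functions constant on principal sets are closed under convolution, convolution on them is
commutative, and level sets of such functions are again unions of principal sets. So the product of
the transposition class with itself, which takes the value 3 exactly on 3-cycles, shows that the
3-cycles form a union of principal sets.

Let `A` be the principal set of (0 1 2), and suppose it misses a 3-cycle. Convolving `A ∪ A⁻¹` with
the transpositions gives a constant on transpositions, so the supports of its cycles form a
2-(6,3,k) design (`eq_two_or`): either k = 2, or every triple occurs. The design with k = 2 is
unique up to relabelling (`IsTripleDesign.exists_relabel`).

If every triple occurs, then `A` and `A⁻¹` are disjoint and `A` orients each triple. Since `A * C₃`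
is constant on `A`, the signed pair sums N(a,b) = ∑ sgn(a,b,c) satisfy N(a,b) + N(b,c) + N(c,a) = λ
sgn(a,b,c), and summing over c gives 6N = λN. Either λ = 6, sgn is a coboundary and `A` is a cyclic
order, or N = 0 and each ordered pair has two positive triples, which again leaves one orientation
up to relabelling.

In each of the three normal forms a level set `Y` built from `A` fails to commute with the form's
indicator, as a finite computation shows at one group element. -/

/-- Convolution of functions on a finite group. -/
def groupConv {G : Type*} [Group G] [Fintype G] (f g : G → ℕ) (x : G) : ℕ :=
  ∑ y, f y * g (y⁻¹ * x)

theorem groupConv_eq_sum_right {G : Type*} [Group G] [Fintype G] (f g : G → ℕ) (x : G) :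
    groupConv f g x = ∑ y, f (x * y⁻¹) * g y := by
  unfold groupConv
  refine Fintype.sum_equiv ((Equiv.inv G).trans (Equiv.mulRight x)) _ _ fun y => ?_
  simp

theorem groupConv_conj {G : Type*} [Group G] [Fintype G] (f g : G → ℕ) (p x : G) :
    groupConv (fun y => f (p * y * p⁻¹)) (fun y => g (p * y * p⁻¹)) x =
      groupConv f g (p * x * p⁻¹) := by
  unfold groupConv
  refine Fintype.sum_equiv (MulAut.conj p).toEquiv _ _ fun y => ?_
  simp [mul_assoc]

/-- A family of functions on a finite group that is closed under convolution, on which convolution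
is commutative, and which is closed under pointwise operations. -/
structure IsCommSchurFamily {G : Type*} [Group G] [Fintype G] (M : (G → ℕ) → Prop) : Prop where
  conv : ∀ f g, M f → M g → M (groupConv f g)
  comm : ∀ f g, M f → M g → groupConv f g = groupConv g f
  comp₂ : ∀ (φ : ℕ → ℕ → ℕ) (f g), M f → M g → M fun x => φ (f x) (g x)

namespace IsCommSchurFamily

variable {G : Type*} [Group G] [Fintype G] {M : (G → ℕ) → Prop}

theorem comp (hM : IsCommSchurFamily M) (φ : ℕ → ℕ) {f : G → ℕ} (hf : M f) :
    M fun x => φ (f x) :=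
  hM.comp₂ (fun a _ => φ a) f f hf hf

/-- Conjugation is a group automorphism. This is what allows the six points to be relabelled freely.
-/
theorem conj (hM : IsCommSchurFamily M) (p : G) :
    IsCommSchurFamily fun f : G → ℕ => M fun x => f (p⁻¹ * x * p) := by
  have key : ∀ (f g : G → ℕ) (x : G), groupConv (fun y => f (p⁻¹ * y * p))
      (fun y => g (p⁻¹ * y * p)) x = groupConv f g (p⁻¹ * x * p) := fun f g x => by
    simpa using groupConv_conj f g p⁻¹ x
  refine ⟨fun f g hf hg => ?_, fun f g hf hg => ?_, fun φ f g hf hg => ?_⟩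
  · have := hM.conv _ _ hf hg
    rwa [funext (key f g)] at this
  · funext x
    have := congrFun (hM.comm _ _ hf hg) (p * x * p⁻¹)
    rw [key, key] at this
    simpa [mul_assoc] using this
  · exact hM.comp₂ φ _ _ hf hg

end IsCommSchurFamily

/-! ### Measurable functions of an S-ring -/

namespace SchurRing

variable {G : Type*} [Group G] [Fintype G] [DecidableEq G]

/-- A function on the group is measurable if it is constant on every principal set. -/
def IsMeasurable (S : SchurRing G) (f : G → ℕ) : Prop :=
  ∀ A ∈ S.partition.parts, ∀ x ∈ A, ∀ y ∈ A, f x = f y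

/-- The element of the group algebra with given coefficients. -/
noncomputable def ofFun (f : G → ℕ) : MonoidAlgebra ℂ G :=
  ∑ x, MonoidAlgebra.single x (f x : ℂ)

theorem coeff_ofFun {G : Type*} [Fintype G] (f : G → ℕ) (x : G) : (ofFun f).coeff x = f x := by
  classical simp [ofFun, Finsupp.single_apply]

theorem coeff_groupSum {G : Type*} [DecidableEq G] (A : Finset G) (x : G) :
    (groupSum A).coeff x = if x ∈ A then 1 else 0 := by
  simp [groupSum, Finsupp.single_apply]

theorem ofFun_mul (f g : G → ℕ) : ofFun f * ofFun g = ofFun (groupConv f g) := by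
  ext x
  rw [coeff_ofFun, ofFun, ofFun, Finset.sum_mul_sum]
  simp only [MonoidAlgebra.single_mul_single, MonoidAlgebra.coeff_sum, Finsupp.coe_finsetSum,
    Finset.sum_apply, MonoidAlgebra.coeff_single, Finsupp.single_apply, groupConv]
  push_cast
  refine Finset.sum_congr rfl fun y _ => ?_
  rw [Finset.sum_eq_single (y⁻¹ * x)]
  · simp
  · intro z _ hz
    rw [if_neg]
    rintro rfl
    simp at hz
  · simp

/-- The principal sets partition the group, so the span of their sums consists of the elements whose
coefficients are constant on each of them. -/
theorem mem_toSubalgebra_iff (S : SchurRing G) (f : G → ℕ) :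
    ofFun f ∈ S.toSubalgebra ↔ S.IsMeasurable f := by
  change ofFun f ∈ Submodule.span ℂ S.basis ↔ _
  constructor
  · intro h A hA x hx y hy
    have key : ∀ a ∈ Submodule.span ℂ S.basis, a.coeff x = a.coeff y := by
      intro a ha
      induction ha using Submodule.span_induction with
      | mem a ha =>
        obtain ⟨B, hB, rfl⟩ := ha
        rw [coeff_groupSum, coeff_groupSum]
        have : x ∈ B ↔ y ∈ B := by
          constructor
          · intro h
            exact S.partition.eq_of_mem_parts hA hB hx h ▸ hy
          · intro h
            exact S.partition.eq_of_mem_parts hA hB hy h ▸ hx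
        simp only [this]
      | zero => simp
      | add a b _ _ ha hb => simp [ha, hb]
      | smul c a _ ha => simp [ha]
    have := key _ h
    rw [coeff_ofFun, coeff_ofFun] at this
    exact_mod_cast this
  · intro h
    have : ofFun f = ∑ A ∈ S.partition.parts.attach,
        (f (S.partition.nonempty_of_mem_parts A.2).choose : ℂ) • groupSum A.1 := by
      ext x
      obtain ⟨B, hB, hx⟩ := S.partition.exists_mem (Finset.mem_univ x)
      simp only [MonoidAlgebra.coeff_sum, Finsupp.coe_finsetSum, Finset.sum_apply,
        MonoidAlgebra.coeff_smul, Finsupp.smul_apply, coeff_groupSum, coeff_ofFun]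
      rw [Finset.sum_eq_single ⟨B, hB⟩]
      · rw [if_pos hx, smul_eq_mul, mul_one]
        exact_mod_cast h B hB _ hx _ (S.partition.nonempty_of_mem_parts hB).choose_spec
      · rintro ⟨C, hC⟩ _ hCB
        rw [if_neg, smul_zero]
        intro hx'
        exact hCB (Subtype.ext (S.partition.eq_of_mem_parts hC hB hx' hx))
      · simp
    rw [this]
    exact Submodule.sum_mem _ fun A _ =>
      Submodule.smul_mem _ _ (Submodule.subset_span ⟨A.1, A.2, rfl⟩)

theorem isCommSchurFamily (S : SchurRing G) (hS : S.IsCommutative) :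
    IsCommSchurFamily S.IsMeasurable := by
  refine ⟨fun f g hf hg => ?_, fun f g hf hg => ?_, fun φ f g hf hg A hA x hx y hy => ?_⟩
  · rw [← mem_toSubalgebra_iff] at *
    rw [← ofFun_mul]
    exact mul_mem hf hg
  · rw [← mem_toSubalgebra_iff] at hf hg
    have h := hS _ hf _ hg
    rw [ofFun_mul, ofFun_mul] at h
    funext x
    have := congrArg (fun a => a.coeff x) h
    simp only [coeff_ofFun] at this
    exact_mod_cast this
  · simp only [hf A hA x hx y hy, hg A hA x hx y hy]

theorem isMeasurable_indicator (S : SchurRing G) {A : Finset G} (hA : A ∈ S.partition.parts) :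
    S.IsMeasurable fun x => if x ∈ A then 1 else 0 := by
  intro B hB x hx y hy
  have : x ∈ A ↔ y ∈ A := by
    constructor
    · intro h
      exact S.partition.eq_of_mem_parts hB hA hx h ▸ hy
    · intro h
      exact S.partition.eq_of_mem_parts hB hA hy h ▸ hx
  simp only [this]

end SchurRing

/-! ### Transpositions and 3-cycles on six points -/

/-- The number of points moved by a permutation of six points. -/
def movedCount (x : Perm (Fin 6)) : ℕ :=
  [0, 1, 2, 3, 4, 5].countP fun i => decide (x i ≠ i)

theorem movedCount_eq_card_support (x : Perm (Fin 6)) : movedCount x = x.support.card := by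
  have : x.support = Finset.univ.filter fun i => x i ≠ i := by ext; simp
  rw [this, Finset.card_filter, Fin.sum_univ_six]
  simp only [movedCount, List.countP_cons, List.countP_nil, decide_eq_true_eq]
  ring

theorem movedCount_eq_two_iff {x : Perm (Fin 6)} : movedCount x = 2 ↔ x.IsSwap := by
  rw [movedCount_eq_card_support, card_support_eq_two]

theorem movedCount_eq_three_iff {x : Perm (Fin 6)} : movedCount x = 3 ↔ x.IsThreeCycle := by
  rw [movedCount_eq_card_support, card_support_eq_three_iff]

theorem movedCount_conj (p x : Perm (Fin 6)) : movedCount (p * x * p⁻¹) = movedCount x := by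
  rw [movedCount_eq_card_support, movedCount_eq_card_support, card_support_conj]

/-- The `3`-cycle `a ↦ b ↦ c ↦ a`, for distinct `a`, `b`, `c`. -/
def triCycle (a b c : Fin 6) : Perm (Fin 6) :=
  swap a b * swap b c

theorem triCycle_conj (p : Perm (Fin 6)) (a b c : Fin 6) :
    p * triCycle a b c * p⁻¹ = triCycle (p a) (p b) (p c) := by
  ext
  simp [triCycle, swap_apply_apply]

theorem triCycle_rotate (a b c : Fin 6) (hab : a ≠ b) (hbc : b ≠ c) (hac : a ≠ c) :
    triCycle b c a = triCycle a b c := by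
  decide +revert +kernel

theorem triCycle_inv (a b c : Fin 6) (hab : a ≠ b) (hbc : b ≠ c) (hac : a ≠ c) :
    (triCycle a b c)⁻¹ = triCycle a c b := by
  decide +revert +kernel

theorem movedCount_triCycle_eq_three_iff (a b c : Fin 6) :
    movedCount (triCycle a b c) = 3 ↔ a ≠ b ∧ b ≠ c ∧ a ≠ c := by
  decide +revert +kernel

theorem exists_eq_triCycle {x : Perm (Fin 6)} (hx : movedCount x = 3) :
    ∃ a b c, a ≠ b ∧ b ≠ c ∧ a ≠ c ∧ x = triCycle a b c := by
  have h3 := movedCount_eq_three_iff.1 hx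
  obtain ⟨a, ha⟩ : x.support.Nonempty := by
    rw [← Finset.card_pos, h3.card_support]; norm_num
  have h := h3.eq_swap_mul_swap_iff_mem_support.2 ha
  refine ⟨a, x a, x (x a), ?_⟩
  have h' : x = triCycle a (x a) (x (x a)) := h
  have := (movedCount_triCycle_eq_three_iff a (x a) (x (x a))).1 (h' ▸ hx)
  exact ⟨this.1, this.2.1, this.2.2, h'⟩

/-- A permutation of six points written as a number in base `8`. -/
def permCode (x : Perm (Fin 6)) : ℕ :=
  x 0 + 8 * x 1 + 64 * x 2 + 512 * x 3 + 4096 * x 4 + 32768 * x 5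

/-- The pairs of distinct elements of `Fin 6`, up to order. -/
def pairList : List (Fin 6 × Fin 6) :=
  [(0, 1), (0, 2), (0, 3), (0, 4), (0, 5), (1, 2), (1, 3), (1, 4), (1, 5), (2, 3), (2, 4),
    (2, 5), (3, 4), (3, 5), (4, 5)]

/-- The triples of distinct elements of `Fin 6`, up to rotation. -/
def tripleList : List (Fin 6 × Fin 6 × Fin 6) :=
  [(0, 1, 2), (0, 1, 3), (0, 1, 4), (0, 1, 5), (0, 2, 1), (0, 2, 3), (0, 2, 4), (0, 2, 5),
    (0, 3, 1), (0, 3, 2), (0, 3, 4), (0, 3, 5), (0, 4, 1), (0, 4, 2), (0, 4, 3), (0, 4, 5),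
    (0, 5, 1), (0, 5, 2), (0, 5, 3), (0, 5, 4), (1, 2, 3), (1, 2, 4), (1, 2, 5), (1, 3, 2),
    (1, 3, 4), (1, 3, 5), (1, 4, 2), (1, 4, 3), (1, 4, 5), (1, 5, 2), (1, 5, 3), (1, 5, 4),
    (2, 3, 4), (2, 3, 5), (2, 4, 3), (2, 4, 5), (2, 5, 3), (2, 5, 4), (3, 4, 5), (3, 5, 4)]

theorem mem_pairList (a b : Fin 6) (hab : a < b) : (a, b) ∈ pairList := by
  decide +revert +kernel

theorem mem_tripleList (a b c : Fin 6) (hab : a < b) (hac : a < c) (hbc : b ≠ c) :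
    (a, b, c) ∈ tripleList := by
  decide +revert +kernel

/-- The transpositions of six points. -/
def swapList : List (Perm (Fin 6)) := pairList.map fun a => swap a.1 a.2

/-- The `3`-cycles of six points. -/
def threeCycleList : List (Perm (Fin 6)) := tripleList.map fun a => triCycle a.1 a.2.1 a.2.2

theorem nodup_swapList : swapList.Nodup := by decide +kernel

theorem nodup_threeCycleList : threeCycleList.Nodup := by
  apply List.Nodup.of_map permCode
  have h : threeCycleList.map permCode =
      [181777, 180377, 165537, 18089, 181826, 180426, 165642, 18250, 180867, 181259,
      166027, 19083, 169604, 173580, 176268, 22156, 50821, 83469, 114829, 132749, 180944,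
      169744, 51024, 181336, 170136, 51864, 173664, 176800, 54944, 83560, 115368, 136872,
      174280, 84680, 177416, 87816, 116040, 141128, 120968, 146056] := by decide +kernel
  rw [h]
  decide +kernel

theorem mem_swapList {x : Perm (Fin 6)} : x ∈ swapList ↔ movedCount x = 2 := by
  constructor
  · have h : ∀ a ∈ pairList, a.1 ≠ a.2 := by decide +kernel
    rw [swapList, List.mem_map, movedCount_eq_two_iff]
    rintro ⟨a, ha, rfl⟩
    exact ⟨_, _, h a ha, rfl⟩
  · rw [movedCount_eq_two_iff]
    rintro ⟨a, b, hab, rfl⟩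
    rcases lt_or_gt_of_ne hab with h | h
    · exact List.mem_map.2 ⟨(a, b), mem_pairList a b h, rfl⟩
    · exact List.mem_map.2 ⟨(b, a), mem_pairList b a h, swap_comm b a⟩

theorem mem_threeCycleList {x : Perm (Fin 6)} : x ∈ threeCycleList ↔ movedCount x = 3 := by
  constructor
  · have h : ∀ a ∈ tripleList, a.1 ≠ a.2.1 ∧ a.2.1 ≠ a.2.2 ∧ a.1 ≠ a.2.2 := by decide +kernel
    rw [threeCycleList, List.mem_map]
    rintro ⟨a, ha, rfl⟩
    exact (movedCount_triCycle_eq_three_iff _ _ _).2 (h a ha)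
  · intro hx
    obtain ⟨a, b, c, hab, hbc, hac, rfl⟩ := exists_eq_triCycle hx
    have key : ∀ a b c : Fin 6, a < b → a < c → b ≠ c → triCycle a b c ∈ threeCycleList :=
      fun a b c hab hac hbc => List.mem_map.2 ⟨(a, b, c), mem_tripleList a b c hab hac hbc, rfl⟩
    -- The listed triples begin with their least entry, so the cycle is rotated until its least
    -- point comes first.
    rcases lt_or_gt_of_ne hab with h₁ | h₁ <;> rcases lt_or_gt_of_ne hbc with h₂ | h₂ <;>
      rcases lt_or_gt_of_ne hac with h₃ | h₃
    · exact key a b c h₁ h₃ hbc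
    · exact key a b c h₁ (h₁.trans h₂) hbc
    · exact key a b c h₁ h₃ hbc
    · rw [triCycle_rotate c a b hac.symm hab hbc.symm]
      exact key c a b h₃ h₂ hab
    · rw [← triCycle_rotate a b c hab hbc hac]
      exact key b c a h₂ h₁ hac.symm
    · rw [← triCycle_rotate a b c hab hbc hac]
      exact key b c a h₂ h₁ hac.symm
    · exact absurd (h₂.trans h₁) h₃.not_gt
    · rw [triCycle_rotate c a b hac.symm hab hbc.symm]
      exact key c a b h₃ h₂ hab

/-! ### Convolution with the classes of transpositions and 3-cycles -/

/-- The indicator function of the permutations moving exactly `k` points. -/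
def movedInd (k : ℕ) (x : Perm (Fin 6)) : ℕ := if movedCount x = k then 1 else 0

theorem groupConv_eq_list_sum_right {f g : Perm (Fin 6) → ℕ} {L : List (Perm (Fin 6))}
    (hL : L.Nodup) (hg : ∀ x, g x = if x ∈ L then 1 else 0) (x : Perm (Fin 6)) :
    groupConv f g x = (L.map fun y => f (x * y⁻¹)).sum := by
  rw [groupConv_eq_sum_right, ← List.sum_toFinset _ hL]
  simp [hg, ← List.mem_toFinset]

theorem groupConv_eq_list_sum_left {f g : Perm (Fin 6) → ℕ} {L : List (Perm (Fin 6))}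
    (hL : L.Nodup) (hf : ∀ x, f x = if x ∈ L then 1 else 0) (x : Perm (Fin 6)) :
    groupConv f g x = (L.map fun y => g (y⁻¹ * x)).sum := by
  rw [groupConv, ← List.sum_toFinset _ hL]
  simp [hf, ← List.mem_toFinset]

theorem movedInd_two (x : Perm (Fin 6)) : movedInd 2 x = if x ∈ swapList then 1 else 0 := by
  simp only [movedInd, mem_swapList]

theorem movedInd_three (x : Perm (Fin 6)) :
    movedInd 3 x = if x ∈ threeCycleList then 1 else 0 := by
  simp only [movedInd, mem_threeCycleList]

theorem list_sum_filter_movedCount {f : Perm (Fin 6) → ℕ} (hf : ∀ x, movedCount x ≠ 3 → f x = 0)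
    (L : List (Perm (Fin 6))) :
    ((L.filter fun x => movedCount x = 3).map f).sum = (L.map f).sum := by
  induction L with
  | nil => rfl
  | cons x L ih =>
    by_cases hx : movedCount x = 3
    · simp [hx, ih]
    · simp [hx, ih, hf x hx]

/-- Only 3-cycles contribute, so an identity of sums for all such `f` reduces to a decidable
comparison of lists. -/
theorem list_sum_eq_of_perm_filter {f : Perm (Fin 6) → ℕ} (hf : ∀ x, movedCount x ≠ 3 → f x = 0)
    {L L' : List (Perm (Fin 6))}
    (h : (L.filter fun x => movedCount x = 3).Perm (L'.filter fun x => movedCount x = 3)) :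
    (L.map f).sum = (L'.map f).sum := by
  rw [← list_sum_filter_movedCount hf, ← list_sum_filter_movedCount hf L', (h.map f).sum_eq]

theorem exists_perm_apply_eq {a b c : Fin 6} (hab : a ≠ b) (hbc : b ≠ c) (hac : a ≠ c) :
    ∃ p : Perm (Fin 6), p 0 = a ∧ p 1 = b ∧ p 2 = c := by
  have h1 : Function.Injective ![(0 : Fin 6), 1, 2] := by decide
  have h2 : Function.Injective ![a, b, c] := by
    intro i j h
    fin_cases i <;> fin_cases j <;> simp_all
  obtain ⟨p, hp⟩ := Equiv.Perm.exists_extending_pair _ _ h1 h2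
  exact ⟨p, by simpa using hp 0, by simpa using hp 1, by simpa using hp 2⟩

theorem groupConv_conj_movedInd (f : Perm (Fin 6) → ℕ) (k : ℕ) (p x : Perm (Fin 6)) :
    groupConv f (movedInd k) (p * x * p⁻¹) =
      groupConv (fun y => f (p * y * p⁻¹)) (movedInd k) x := by
  have : movedInd k = fun y => movedInd k (p * y * p⁻¹) := by
    funext y
    simp only [movedInd, movedCount_conj]
  rw [← groupConv_conj]
  exact congrFun (congrArg _ this.symm) x

theorem list_sum_flatMap_two (f : Perm (Fin 6) → ℕ) (u v : Fin 6 → Perm (Fin 6)) :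
    ((([0, 1, 2, 3, 4, 5] : List (Fin 6)).flatMap fun d => [u d, v d]).map f).sum =
      ∑ d, (f (u d) + f (v d)) := by
  simp [Fin.sum_univ_six, add_assoc]

theorem list_sum_flatMap_three (f : Perm (Fin 6) → ℕ) (u v w : Fin 6 → Perm (Fin 6)) :
    ((([0, 1, 2, 3, 4, 5] : List (Fin 6)).flatMap fun d => [u d, v d, w d]).map f).sum =
      ∑ d, (f (u d) + f (v d) + f (w d)) := by
  simp [Fin.sum_univ_six, add_assoc]

/-- The product (0 1)y⁻¹ is a 3-cycle exactly when the transposition y meets {0, 1} in one point.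
The degenerate values d = 0, 1 are removed by the filter. -/
theorem perm_filter_swap :
    ((swapList.map fun y => swap 0 1 * y⁻¹).filter fun x => movedCount x = 3).Perm
      ((([0, 1, 2, 3, 4, 5] : List (Fin 6)).flatMap fun d =>
        [triCycle 0 1 d, triCycle 1 0 d]).filter fun x => movedCount x = 3) := by
  decide +kernel

/-- The three extra copies on the left match d = 2, 0, 1 in the three families on the right, each of
which gives (0 1 2) again. The cycle (0 2 1) is the square of (0 1 2). -/
theorem perm_filter_triCycle :
    ((threeCycleList.map (fun y => triCycle 0 1 2 * y⁻¹) ++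
        [triCycle 0 1 2, triCycle 0 1 2, triCycle 0 1 2]).filter fun x => movedCount x = 3).Perm
      ((triCycle 0 2 1 :: ([0, 1, 2, 3, 4, 5] : List (Fin 6)).flatMap fun d =>
        [triCycle 0 1 d, triCycle 1 2 d, triCycle 2 0 d]).filter fun x => movedCount x = 3) := by
  decide +kernel

theorem groupConv_movedInd_swap {f : Perm (Fin 6) → ℕ} (hf : ∀ x, movedCount x ≠ 3 → f x = 0)
    {a b : Fin 6} (hab : a ≠ b) :
    groupConv f (movedInd 2) (swap a b) = ∑ d, (f (triCycle a b d) + f (triCycle b a d)) := by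
  -- The third point serves only to apply `exists_perm_apply_eq`.
  obtain ⟨c, hac, hbc⟩ : ∃ c : Fin 6, c ≠ a ∧ c ≠ b := by
    clear hf
    decide +revert
  obtain ⟨p, rfl, rfl, rfl⟩ := exists_perm_apply_eq hab hbc.symm hac.symm
  have hs : swap (p 0) (p 1) = p * swap 0 1 * p⁻¹ := swap_apply_apply p 0 1
  rw [hs, groupConv_conj_movedInd, groupConv_eq_list_sum_right nodup_swapList movedInd_two]
  have hf' : ∀ x, movedCount x ≠ 3 → f (p * x * p⁻¹) = 0 := fun x hx =>
    hf _ (by rwa [movedCount_conj])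
  have h := list_sum_eq_of_perm_filter hf' perm_filter_swap
  rw [List.map_map, list_sum_flatMap_two] at h
  refine h.trans ?_
  simp only [triCycle_conj]
  exact Equiv.sum_comp p fun d => f (triCycle (p 0) (p 1) d) + f (triCycle (p 1) (p 0) d)

theorem groupConv_movedInd_triCycle {f : Perm (Fin 6) → ℕ}
    (hf : ∀ x, movedCount x ≠ 3 → f x = 0)
    {a b c : Fin 6} (hab : a ≠ b) (hbc : b ≠ c) (hac : a ≠ c) :
    groupConv f (movedInd 3) (triCycle a b c) + 3 * f (triCycle a b c) = f (triCycle a c b) +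
      ∑ d, (f (triCycle a b d) + f (triCycle b c d) + f (triCycle c a d)) := by
  obtain ⟨p, rfl, rfl, rfl⟩ := exists_perm_apply_eq hab hbc hac
  rw [← triCycle_conj, groupConv_conj_movedInd,
    groupConv_eq_list_sum_right nodup_threeCycleList movedInd_three]
  have hf' : ∀ x, movedCount x ≠ 3 → f (p * x * p⁻¹) = 0 := fun x hx =>
    hf _ (by rwa [movedCount_conj])
  have h := list_sum_eq_of_perm_filter hf' perm_filter_triCycle
  simp only [List.map_append, List.sum_append, List.map_map, List.map_cons, List.sum_cons,
    List.map_nil, List.sum_nil, list_sum_flatMap_three, Function.comp_def, triCycle_conj] at h ⊢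
  have e := Equiv.sum_comp p fun d =>
    f (triCycle (p 0) (p 1) d) + f (triCycle (p 1) (p 2) d) + f (triCycle (p 2) (p 0) d)
  lia

/-- The number of factorizations into two transpositions is 15 for the identity, 2 for a double
transposition and 3 for a 3-cycle. -/
theorem list_sum_swap_mul_swap (a b c d : Fin 6) (hab : a < b) (hcd : c < d) :
    (swapList.map fun y => movedInd 2 (y⁻¹ * (swap a b * swap c d))).sum = 3 ↔
      movedCount (swap a b * swap c d) = 3 := by
  decide +revert +kernel

theorem exists_lt_eq_swap {x : Perm (Fin 6)} (hx : x.IsSwap) : ∃ a b, a < b ∧ x = swap a b := by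
  obtain ⟨a, b, hab, rfl⟩ := hx
  rcases lt_or_gt_of_ne hab with h | h
  · exact ⟨a, b, h, rfl⟩
  · exact ⟨b, a, h, swap_comm a b⟩

theorem groupConv_movedInd_two_eq_three_iff (x : Perm (Fin 6)) :
    groupConv (movedInd 2) (movedInd 2) x = 3 ↔ movedCount x = 3 := by
  have key : ∀ y z : Perm (Fin 6), y.IsSwap → z.IsSwap →
      (groupConv (movedInd 2) (movedInd 2) (y * z) = 3 ↔ movedCount (y * z) = 3) := by
    intro y z hy hz
    obtain ⟨a, b, hab, rfl⟩ := exists_lt_eq_swap hy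
    obtain ⟨c, d, hcd, rfl⟩ := exists_lt_eq_swap hz
    rw [groupConv_eq_list_sum_left nodup_swapList movedInd_two]
    exact list_sum_swap_mul_swap a b c d hab hcd
  constructor
  · intro h
    obtain ⟨y, -, hy⟩ := Finset.exists_ne_zero_of_sum_ne_zero
      (show ∑ y, movedInd 2 y * movedInd 2 (y⁻¹ * x) ≠ 0 from fun h0 => by
        rw [groupConv, h0] at h
        cases h)
    have h1 : movedCount y = 2 := by
      by_contra h'
      simp [movedInd, h'] at hy
    have h2 : movedCount (y⁻¹ * x) = 2 := by
      by_contra h'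
      simp [movedInd, h'] at hy
    have := key y (y⁻¹ * x) (movedCount_eq_two_iff.1 h1) (movedCount_eq_two_iff.1 h2)
    rw [mul_inv_cancel_left] at this
    exact this.1 h
  · intro h
    obtain ⟨a, b, c, hab, hbc, hac, rfl⟩ := exists_eq_triCycle h
    exact (key (swap a b) (swap b c) ⟨a, b, hab, rfl⟩ ⟨b, c, hbc, rfl⟩).2 h

/-! ### Permutations coded as natural numbers -/

/-- The digit `i` of `c` in base `8`. -/
def codeDigit (c i : ℕ) : ℕ := Nat.mod (Nat.div c (Nat.pow 8 i)) 8

/-- The product of permutations given by their codes. -/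
def codeMul (c d : ℕ) : ℕ :=
  Nat.add (codeDigit c (codeDigit d 0)) <|
  Nat.add (Nat.mul 8 (codeDigit c (codeDigit d 1))) <|
  Nat.add (Nat.mul 64 (codeDigit c (codeDigit d 2))) <|
  Nat.add (Nat.mul 512 (codeDigit c (codeDigit d 3))) <|
  Nat.add (Nat.mul 4096 (codeDigit c (codeDigit d 4)))
    (Nat.mul 32768 (codeDigit c (codeDigit d 5)))

/-- The number of points moved by the permutation with the given code. -/
def codeMovedCount (c : ℕ) : ℕ := [0, 1, 2, 3, 4, 5].countP fun i => !(Nat.beq (codeDigit c i) i)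

/-- The sum of `f (d c)` over the codes `d` in `L`. -/
def codeSumLeft (L : List ℕ) (f : ℕ → ℕ) (c : ℕ) : ℕ :=
  L.foldr (fun d s => Nat.add (f (codeMul d c)) s) 0

/-- The sum of `f (c d)` over the codes `d` in `L`. -/
def codeSumRight (f : ℕ → ℕ) (L : List ℕ) (c : ℕ) : ℕ :=
  L.foldr (fun d s => Nat.add (f (codeMul c d)) s) 0

/-- The indicator function of the level set `f = k`. -/
def codeLevel (k : ℕ) (f : ℕ → ℕ) (c : ℕ) : ℕ := cond (Nat.beq (f c) k) 1 0

theorem natBeq_eq_decide (a b : ℕ) : Nat.beq a b = decide (a = b) := by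
  rw [Bool.eq_iff_iff]
  simp

theorem codeDigit_permCode (x : Perm (Fin 6)) (i : Fin 6) : codeDigit (permCode x) i = x i := by
  have h : ∀ c i, codeDigit c i = c / 8 ^ i % 8 := fun _ _ => rfl
  rw [h, permCode]
  have h0 := (x 0).isLt
  have h1 := (x 1).isLt
  have h2 := (x 2).isLt
  have h3 := (x 3).isLt
  have h4 := (x 4).isLt
  have h5 := (x 5).isLt
  fin_cases i <;> simp only [Fin.reduceFinMk] <;> norm_num <;> omega

/-- The code operations use only primitive arithmetic of ℕ, which the kernel evaluates fast; this
carries the group law over to them. -/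
theorem codeMul_permCode (x y : Perm (Fin 6)) :
    codeMul (permCode x) (permCode y) = permCode (x * y) := by
  have h : ∀ i : Fin 6, codeDigit (permCode x) (codeDigit (permCode y) i) = x (y i) := fun i => by
    rw [codeDigit_permCode, codeDigit_permCode]
  have h0 := h 0
  have h1 := h 1
  have h2 := h 2
  have h3 := h 3
  have h4 := h 4
  have h5 := h 5
  simp only [Fin.isValue, Fin.coe_ofNat_eq_mod, Nat.reduceMod] at h0 h1 h2 h3 h4 h5
  rw [codeMul, h0, h1, h2, h3, h4, h5]
  simp only [permCode, Nat.add_eq, Nat.mul_eq, Equiv.Perm.mul_apply]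
  ring

theorem codeMovedCount_permCode (x : Perm (Fin 6)) :
    codeMovedCount (permCode x) = movedCount x := by
  have h : ∀ i : Fin 6, (!(Nat.beq (codeDigit (permCode x) i) i)) = decide (x i ≠ i) := fun i => by
    rw [codeDigit_permCode, natBeq_eq_decide]
    simp [Fin.ext_iff]
  have h0 := h 0
  have h1 := h 1
  have h2 := h 2
  have h3 := h 3
  have h4 := h 4
  have h5 := h 5
  simp only [Fin.isValue, Fin.coe_ofNat_eq_mod, Nat.reduceMod] at h0 h1 h2 h3 h4 h5
  simp only [codeMovedCount, movedCount, List.countP_cons, List.countP_nil, h0, h1, h2, h3, h4, h5]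

theorem codeLevel_movedCount (k : ℕ) (x : Perm (Fin 6)) :
    codeLevel k codeMovedCount (permCode x) = movedInd k x := by
  rw [codeLevel, codeMovedCount_permCode, movedInd, natBeq_eq_decide]
  simp [cond_eq_ite]

theorem codeLevel_permCode (k : ℕ) {f : ℕ → ℕ} {g : Perm (Fin 6) → ℕ}
    (h : ∀ x, f (permCode x) = g x) (x : Perm (Fin 6)) :
    codeLevel k f (permCode x) = if g x = k then 1 else 0 := by
  rw [codeLevel, h, natBeq_eq_decide]
  simp [cond_eq_ite]

/-- The convolution sums g(y⁻¹x), so `C` lists the codes of inverses. -/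
theorem codeSumLeft_eq_groupConv {L : List (Perm (Fin 6))} {C : List ℕ}
    {f : ℕ → ℕ} {g X : Perm (Fin 6) → ℕ} (hL : L.Nodup) (hX : ∀ x, X x = if x ∈ L then 1 else 0)
    (hC : L.map (fun y => permCode y⁻¹) = C) (h : ∀ x, f (permCode x) = g x) (x : Perm (Fin 6)) :
    codeSumLeft C f (permCode x) = groupConv X g x := by
  rw [groupConv_eq_list_sum_left hL hX, ← hC]
  clear hX hL hC
  induction L with
  | nil => rfl
  | cons y L ih =>
    have e : codeSumLeft ((y :: L).map fun y => permCode y⁻¹) f (permCode x) =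
      f (codeMul (permCode y⁻¹) (permCode x)) +
        codeSumLeft (L.map fun y => permCode y⁻¹) f (permCode x) := rfl
    rw [e, ih, codeMul_permCode, h, List.map_cons, List.sum_cons]

theorem codeSumRight_eq_groupConv {L : List (Perm (Fin 6))} {C : List ℕ}
    {f : ℕ → ℕ} {g X : Perm (Fin 6) → ℕ} (hL : L.Nodup) (hX : ∀ x, X x = if x ∈ L then 1 else 0)
    (hC : L.map (fun y => permCode y⁻¹) = C) (h : ∀ x, f (permCode x) = g x) (x : Perm (Fin 6)) :
    codeSumRight f C (permCode x) = groupConv g X x := by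
  rw [groupConv_eq_list_sum_right hL hX, ← hC]
  clear hX hL hC
  induction L with
  | nil => rfl
  | cons y L ih =>
    have e : codeSumRight f ((y :: L).map fun y => permCode y⁻¹) (permCode x) =
      f (codeMul (permCode x) (permCode y⁻¹)) +
        codeSumRight f (L.map fun y => permCode y⁻¹) (permCode x) := rfl
    rw [e, ih, codeMul_permCode, h, List.map_cons, List.sum_cons]

/-! ### The three exceptional sets of 3-cycles, and their failure to commute -/

/-- Both orientations of the blocks of the `2-(6,3,2)` design whose blocks through `0` form the
pentagon `1, 2, 3, 4, 5`. -/
def pentagonTriples : List (Fin 6 × Fin 6 × Fin 6) :=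
  [(0, 1, 2), (0, 1, 5), (0, 2, 1), (0, 2, 3), (0, 3, 2), (0, 3, 4), (0, 4, 3), (0, 4, 5),
    (0, 5, 1), (0, 5, 4), (1, 2, 4), (1, 3, 4), (1, 3, 5), (1, 4, 2), (1, 4, 3), (1, 5, 3),
    (2, 3, 5), (2, 4, 5), (2, 5, 3), (2, 5, 4)]

/-- The `3`-cycles given by `pentagonTriples`. -/
def pentagonCycles : List (Perm (Fin 6)) := pentagonTriples.map fun a => triCycle a.1 a.2.1 a.2.2

/-- The codes of the inverses of the `3`-cycles in `pentagonCycles`. -/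
def pentagonCodes : List ℕ :=
  [181826, 50821, 181777, 181259, 180426, 176268, 166027, 132749, 18089, 22156, 173664,
    176800, 115368, 169744, 170136, 51864, 116040, 141128, 84680, 87816]

theorem pentagonCycles_map_permCode : pentagonCycles.map (fun y => permCode y⁻¹) =
    pentagonCodes := by
  decide +kernel

theorem nodup_pentagonCycles : pentagonCycles.Nodup := by
  apply List.Nodup.of_map fun y => permCode y⁻¹
  rw [pentagonCycles_map_permCode]
  decide +kernel

/-- The triples in the cyclic order `0, 1, 2, 3, 4, 5`. -/
def cyclicOrderTriples : List (Fin 6 × Fin 6 × Fin 6) :=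
  [(0, 1, 2), (0, 1, 3), (0, 1, 4), (0, 1, 5), (0, 2, 3), (0, 2, 4), (0, 2, 5), (0, 3, 4),
    (0, 3, 5), (0, 4, 5), (1, 2, 3), (1, 2, 4), (1, 2, 5), (1, 3, 4), (1, 3, 5), (1, 4, 5),
    (2, 3, 4), (2, 3, 5), (2, 4, 5), (3, 4, 5)]

/-- The `3`-cycles given by `cyclicOrderTriples`. -/
def cyclicOrderCycles : List (Perm (Fin 6)) := cyclicOrderTriples.map fun a => triCycle a.1 a.2.1 a.2.2

/-- The codes of the inverses of the `3`-cycles in `cyclicOrderCycles`. -/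
def cyclicOrderCodes : List ℕ :=
  [181826, 180867, 169604, 50821, 181259, 173580, 83469, 176268, 114829, 132749, 181336,
    173664, 83560, 176800, 115368, 136872, 177416, 116040, 141128, 146056]

theorem cyclicOrderCycles_map_permCode : cyclicOrderCycles.map (fun y => permCode y⁻¹) =
    cyclicOrderCodes := by
  decide +kernel

theorem nodup_cyclicOrderCycles : cyclicOrderCycles.Nodup := by
  apply List.Nodup.of_map fun y => permCode y⁻¹
  rw [cyclicOrderCycles_map_permCode]
  decide +kernel

/-- An orientation of all triples for which each pair `a, b` has as many positive triples `(a, b, c)`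
as negative ones. -/
def dualOrderTriples : List (Fin 6 × Fin 6 × Fin 6) :=
  [(0, 1, 2), (0, 1, 3), (0, 2, 3), (0, 2, 4), (0, 3, 4), (0, 3, 5), (0, 4, 1), (0, 4, 5),
    (0, 5, 1), (0, 5, 2), (1, 2, 4), (1, 3, 2), (1, 4, 3), (1, 4, 5), (1, 5, 2), (1, 5, 3),
    (2, 3, 4), (2, 5, 3), (2, 5, 4), (3, 5, 4)]

/-- The `3`-cycles given by `dualOrderTriples`. -/
def dualOrderCycles : List (Perm (Fin 6)) := dualOrderTriples.map fun a => triCycle a.1 a.2.1 a.2.2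

/-- The codes of the inverses of the `3`-cycles in `dualOrderCycles`. -/
def dualOrderCodes : List ℕ :=
  [181826, 180867, 181259, 173580, 176268, 114829, 165537, 132749, 18089, 18250, 173664,
    180944, 170136, 136872, 51024, 51864, 177416, 84680, 87816, 120968]

theorem dualOrderCycles_map_permCode : dualOrderCycles.map (fun y => permCode y⁻¹) =
    dualOrderCodes := by
  decide +kernel

theorem nodup_dualOrderCycles : dualOrderCycles.Nodup := by
  apply List.Nodup.of_map fun y => permCode y⁻¹
  rw [dualOrderCycles_map_permCode]
  decide +kernel

/-- Here `Y` arises from the transpositions by convolving with the pentagon cycles and taking a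
level set, twice. The number 133841 codes the 6-cycle (0 1 2 3 5 4). -/
theorem codeSum_pentagonCodes_ne (Y : ℕ → ℕ)
    (hY : Y = codeLevel 6 (codeSumLeft pentagonCodes
      (codeLevel 1 (codeSumLeft pentagonCodes (codeLevel 2 codeMovedCount))))) :
    codeSumLeft pentagonCodes Y 133841 ≠ codeSumRight Y pentagonCodes 133841 := by
  subst hY
  decide +kernel

/-- The number 47888 codes the 5-cycle (1 2 4 3 5). -/
theorem codeSum_cyclicOrderCodes_ne (Y : ℕ → ℕ)
    (hY : Y = codeLevel 1 (codeSumLeft cyclicOrderCodes (codeLevel 3 codeMovedCount))) :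
    codeSumLeft cyclicOrderCodes Y 47888 ≠ codeSumRight Y cyclicOrderCodes 47888 := by
  subst hY
  decide +kernel

/-- The number 84680 codes the 3-cycle (2 3 5). -/
theorem codeSum_dualOrderCodes_ne (Y : ℕ → ℕ)
    (hY : Y = codeLevel 1 (codeSumLeft dualOrderCodes (codeLevel 3 codeMovedCount))) :
    codeSumLeft dualOrderCodes Y 84680 ≠ codeSumRight Y dualOrderCodes 84680 := by
  subst hY
  decide +kernel

namespace IsCommSchurFamily

variable {M : (Perm (Fin 6) → ℕ) → Prop} {X : Perm (Fin 6) → ℕ}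

theorem level (hM : IsCommSchurFamily M) (k : ℕ) {f : Perm (Fin 6) → ℕ} (hf : M f) :
    M fun x => if f x = k then 1 else 0 :=
  hM.comp (fun n => if n = k then 1 else 0) hf

theorem not_pentagon (hM : IsCommSchurFamily M) (h2 : M (movedInd 2)) (hX : M X)
    (h : ∀ x, X x = if x ∈ pentagonCycles then 1 else 0) : False := by
  have e1 := codeLevel_permCode 1 (codeSumLeft_eq_groupConv nodup_pentagonCycles h
    pentagonCycles_map_permCode (codeLevel_movedCount 2))
  have m1 := hM.level 1 (hM.conv _ _ hX h2)
  have e2 := codeLevel_permCode 6 (codeSumLeft_eq_groupConv nodup_pentagonCycles h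
    pentagonCycles_map_permCode e1)
  have m2 := hM.level 6 (hM.conv _ _ hX m1)
  have hg : permCode (swap 0 1 * swap 1 2 * swap 2 3 * swap 3 5 * swap 5 4) = 133841 := by
    decide +kernel
  refine codeSum_pentagonCodes_ne _ rfl ?_
  rw [← hg, codeSumLeft_eq_groupConv nodup_pentagonCycles h pentagonCycles_map_permCode e2,
    codeSumRight_eq_groupConv nodup_pentagonCycles h pentagonCycles_map_permCode e2,
    hM.comm _ _ hX m2]

theorem not_cyclicOrder (hM : IsCommSchurFamily M) (h3 : M (movedInd 3)) (hX : M X)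
    (h : ∀ x, X x = if x ∈ cyclicOrderCycles then 1 else 0) : False := by
  have e := codeLevel_permCode 1 (codeSumLeft_eq_groupConv nodup_cyclicOrderCycles h
    cyclicOrderCycles_map_permCode (codeLevel_movedCount 3))
  have m := hM.level 1 (hM.conv _ _ hX h3)
  have hg : permCode (swap 1 2 * swap 2 4 * swap 4 3 * swap 3 5) = 47888 := by
    decide +kernel
  refine codeSum_cyclicOrderCodes_ne _ rfl ?_
  rw [← hg, codeSumLeft_eq_groupConv nodup_cyclicOrderCycles h cyclicOrderCycles_map_permCode e,
    codeSumRight_eq_groupConv nodup_cyclicOrderCycles h cyclicOrderCycles_map_permCode e,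
    hM.comm _ _ hX m]

theorem not_dualOrder (hM : IsCommSchurFamily M) (h3 : M (movedInd 3)) (hX : M X)
    (h : ∀ x, X x = if x ∈ dualOrderCycles then 1 else 0) : False := by
  have e := codeLevel_permCode 1 (codeSumLeft_eq_groupConv nodup_dualOrderCycles h
    dualOrderCycles_map_permCode (codeLevel_movedCount 3))
  have m := hM.level 1 (hM.conv _ _ hX h3)
  have hg : permCode (swap 2 3 * swap 3 5) = 84680 := by
    decide +kernel
  refine codeSum_dualOrderCodes_ne _ rfl ?_
  rw [← hg, codeSumLeft_eq_groupConv nodup_dualOrderCycles h dualOrderCycles_map_permCode e,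
    codeSumRight_eq_groupConv nodup_dualOrderCycles h dualOrderCycles_map_permCode e,
    hM.comm _ _ hX m]

end IsCommSchurFamily

/-! ### Designs of triples on six points -/

/-- `w` is the characteristic function of the blocks, of size `3`, of a design on six points in
which each pair of points lies in `k` blocks. -/
structure IsTripleDesign (w : Fin 6 → Fin 6 → Fin 6 → ℕ) (k : ℕ) : Prop where
  rotate : ∀ a b c, w b c a = w a b c
  swap : ∀ a b c, w a c b = w a b c
  zero : ∀ a b, w a a b = 0
  le_one : ∀ a b c, w a b c ≤ 1
  sum : ∀ a b, a ≠ b → ∑ c, w a b c = k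

namespace IsTripleDesign

variable {w : Fin 6 → Fin 6 → Fin 6 → ℕ} {k : ℕ}

theorem relabel (h : IsTripleDesign w k) (p : Perm (Fin 6)) :
    IsTripleDesign (fun a b c => w (p a) (p b) (p c)) k where
  rotate _ _ _ := h.rotate _ _ _
  swap _ _ _ := h.swap _ _ _
  zero _ _ := h.zero _ _
  le_one _ _ _ := h.le_one _ _ _
  sum a b hab := by
    rw [Equiv.sum_comp p fun c => w (p a) (p b) c]
    exact h.sum _ _ (p.injective.ne hab)

theorem zero' (h : IsTripleDesign w k) (a b : Fin 6) : w a b a = 0 := by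
  rw [h.swap, h.zero]

theorem zero'' (h : IsTripleDesign w k) (a b : Fin 6) : w a b b = 0 := by
  rw [← h.rotate, h.zero]

/-- The order condition makes this a terminating rewrite rule that sorts the indices. -/
theorem swap_of_lt (h : IsTripleDesign w k) {a b : Fin 6} (c : Fin 6) (_ : b < a) :
    w a b c = w b a c := by
  rw [← h.rotate, h.swap]

theorem swap_of_lt' (h : IsTripleDesign w k) (a : Fin 6) {b c : Fin 6} (_ : c < b) :
    w a b c = w a c b :=
  h.swap _ _ _

theorem eq_two_or (h : IsTripleDesign w k) (h1 : w 0 1 2 = 1) :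
    k = 2 ∨ ∀ a b c, a ≠ b → b ≠ c → a ≠ c → w a b c = 1 := by
  -- The link of 0 is a k-regular simple graph on five vertices, so 5k is even and k ≤ 4; the block
  -- 012 excludes k = 0.
  have key : k = 2 ∨ k = 4 := by
    have e1 := h.sum 0 1 (by decide)
    have e2 := h.sum 0 2 (by decide)
    have e3 := h.sum 0 3 (by decide)
    have e4 := h.sum 0 4 (by decide)
    have e5 := h.sum 0 5 (by decide)
    simp only [Fin.sum_univ_six, h.zero', h.zero'', h.swap_of_lt',
      Fin.reduceLT] at e1 e2 e3 e4 e5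
    have l1 := h.le_one 0 1 2
    have l2 := h.le_one 0 1 3
    have l3 := h.le_one 0 1 4
    have l4 := h.le_one 0 1 5
    lia
  refine key.imp id fun hk a b c hab hbc hac => ?_
  by_contra hc
  have hc0 : w a b c = 0 := by
    have := h.le_one a b c
    lia
  have hs := h.sum a b hab
  -- A missing block abc leaves at most three blocks through a and b, fewer than k = 4.
  have hle : ∑ d, w a b d ≤ ∑ d, if d = a ∨ d = b ∨ d = c then 0 else 1 := by
    refine Finset.sum_le_sum fun d _ => ?_
    split_ifs with hd
    · rcases hd with rfl | rfl | rfl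
      · rw [h.zero']
      · rw [h.zero'']
      · rw [hc0]
    · exact h.le_one _ _ _
  have h3 : ∀ a b c : Fin 6, a ≠ b → b ≠ c → a ≠ c →
    (∑ d, if d = a ∨ d = b ∨ d = c then 0 else 1) = 3 := by decide +kernel
  rw [h3 a b c hab hbc hac] at hle
  lia

/-- The link of 0 is 2-regular and contains the path 5, 1, 2, 3, so it is the pentagon; the pair
counts then determine the blocks avoiding 0. -/
theorem eq_pentagon (h : IsTripleDesign w 2) (h1 : w 0 1 2 = 1) (h2 : w 0 1 5 = 1)
    (h3 : w 0 2 3 = 1) (a : Fin 6 × Fin 6 × Fin 6) (ha : a ∈ tripleList) :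
    w a.1 a.2.1 a.2.2 = if a ∈ pentagonTriples then 1 else 0 := by
  have e01 := h.sum 0 1 (by decide)
  have e02 := h.sum 0 2 (by decide)
  have e03 := h.sum 0 3 (by decide)
  have e04 := h.sum 0 4 (by decide)
  have e05 := h.sum 0 5 (by decide)
  have e12 := h.sum 1 2 (by decide)
  have e13 := h.sum 1 3 (by decide)
  have e14 := h.sum 1 4 (by decide)
  have e15 := h.sum 1 5 (by decide)
  have e23 := h.sum 2 3 (by decide)
  have e24 := h.sum 2 4 (by decide)
  have e25 := h.sum 2 5 (by decide)
  have e34 := h.sum 3 4 (by decide)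
  have e35 := h.sum 3 5 (by decide)
  have e45 := h.sum 4 5 (by decide)
  simp only [Fin.sum_univ_six, h.zero', h.zero'', h.swap_of_lt, h.swap_of_lt',
    Fin.reduceLT] at e01 e02 e03 e04 e05 e12 e13 e14 e15 e23 e24 e25 e34 e35 e45
  have l012 := h.le_one 0 1 2
  have l013 := h.le_one 0 1 3
  have l014 := h.le_one 0 1 4
  have l015 := h.le_one 0 1 5
  have l023 := h.le_one 0 2 3
  have l024 := h.le_one 0 2 4
  have l025 := h.le_one 0 2 5
  have l034 := h.le_one 0 3 4
  have l035 := h.le_one 0 3 5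
  have l045 := h.le_one 0 4 5
  have l123 := h.le_one 1 2 3
  have l124 := h.le_one 1 2 4
  have l125 := h.le_one 1 2 5
  have l134 := h.le_one 1 3 4
  have l135 := h.le_one 1 3 5
  have l145 := h.le_one 1 4 5
  have l234 := h.le_one 2 3 4
  have l235 := h.le_one 2 3 5
  have l245 := h.le_one 2 4 5
  have l345 := h.le_one 3 4 5
  have v013 : w 0 1 3 = 0 := by omega
  have v014 : w 0 1 4 = 0 := by omega
  have v024 : w 0 2 4 = 0 := by omega
  have v025 : w 0 2 5 = 0 := by omega
  have v034 : w 0 3 4 = 1 := by omega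
  have v035 : w 0 3 5 = 0 := by omega
  have v045 : w 0 4 5 = 1 := by omega
  simp only [h1, h2, h3, v013, v014, v024, v025, v034, v035, v045] at e12 e13 e14 e15 e23 e24 e25 e34 e35 e45
  have v123 : w 1 2 3 = 0 := by omega
  have v124 : w 1 2 4 = 1 := by omega
  have v125 : w 1 2 5 = 0 := by omega
  have v134 : w 1 3 4 = 1 := by omega
  have v135 : w 1 3 5 = 1 := by omega
  have v145 : w 1 4 5 = 0 := by omega
  have v234 : w 2 3 4 = 0 := by omega
  have v235 : w 2 3 5 = 1 := by omega
  have v245 : w 2 4 5 = 1 := by omega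
  have v345 : w 3 4 5 = 0 := by omega
  fin_cases ha <;> simp [pentagonTriples, h.swap_of_lt', *]

theorem exists_relabel_row (h : IsTripleDesign w 2) :
    ∃ p : Perm (Fin 6), w (p 0) (p 1) (p 2) = 1 ∧ w (p 0) (p 1) (p 5) = 1 := by
  have e := h.sum 0 1 (by decide)
  simp only [Fin.sum_univ_six, h.zero', h.zero''] at e
  have l2 := h.le_one 0 1 2
  have l3 := h.le_one 0 1 3
  have l4 := h.le_one 0 1 4
  have l5 := h.le_one 0 1 5
  by_cases h2 : w 0 1 2 = 1 <;> by_cases h5 : w 0 1 5 = 1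
  · exact ⟨1, h2, h5⟩
  · by_cases h3 : w 0 1 3 = 1
    · exact ⟨Equiv.swap 3 5, h2, h3⟩
    · exact ⟨Equiv.swap 4 5, h2, show w 0 1 4 = 1 by lia⟩
  · by_cases h3 : w 0 1 3 = 1
    · exact ⟨Equiv.swap 2 3, h3, h5⟩
    · exact ⟨Equiv.swap 2 4, show w 0 1 4 = 1 by lia, h5⟩
  · exact ⟨Equiv.swap 2 3 * Equiv.swap 4 5, show w 0 1 3 = 1 by lia, show w 0 1 4 = 1 by lia⟩

theorem exists_relabel (h : IsTripleDesign w 2) :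
    ∃ p : Perm (Fin 6), ∀ a ∈ tripleList,
      w (p a.1) (p a.2.1) (p a.2.2) = if a ∈ pentagonTriples then 1 else 0 := by
  obtain ⟨p, h2, h5⟩ := h.exists_relabel_row
  have hp := h.relabel p
  by_cases h3 : w (p 0) (p 2) (p 3) = 1
  · exact ⟨p, hp.eq_pentagon h2 h5 h3⟩
  -- The path 5, 1, 2 in the link of 0 cannot close up to a triangle, since 3 and 4 would then have
  -- too few neighbours. So 2 is joined to 3 or to 4.
  · refine ⟨p * Equiv.swap 3 4, (hp.relabel (Equiv.swap 3 4)).eq_pentagon h2 h5 ?_⟩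
    change w (p 0) (p 2) (p 4) = 1
    generalize hw : (fun a b c => w (p a) (p b) (p c)) = v at hp
    have hv : ∀ a b c, w (p a) (p b) (p c) = v a b c := fun a b c => by rw [← hw]
    rw [hv] at h2 h5 h3 ⊢
    have e1 := hp.sum 0 1 (by decide)
    have e2 := hp.sum 0 2 (by decide)
    have e3 := hp.sum 0 3 (by decide)
    have e4 := hp.sum 0 4 (by decide)
    have e5 := hp.sum 0 5 (by decide)
    simp only [Fin.sum_univ_six, hp.zero', hp.zero'', hp.swap_of_lt', Fin.reduceLT]
      at e1 e2 e3 e4 e5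
    have l3 := hp.le_one 0 2 3
    have l4 := hp.le_one 0 3 4
    have l4 := hp.le_one 0 2 4
    omega

end IsTripleDesign

/-! ### Orientations of triples on six points -/

/-- `t` chooses one of the two cyclic orders on each triple. -/
structure IsTripleOrientation (t : Fin 6 → Fin 6 → Fin 6 → ℕ) : Prop where
  rotate : ∀ a b c, t b c a = t a b c
  zero : ∀ a b, t a a b = 0
  add_swap : ∀ a b c, a ≠ b → b ≠ c → a ≠ c → t a b c + t a c b = 1

namespace IsTripleOrientation

variable {t : Fin 6 → Fin 6 → Fin 6 → ℕ}

theorem relabel (h : IsTripleOrientation t) (p : Perm (Fin 6)) :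
    IsTripleOrientation (fun a b c => t (p a) (p b) (p c)) where
  rotate _ _ _ := h.rotate _ _ _
  zero _ _ := h.zero _ _
  add_swap _ _ _ hab hbc hac :=
    h.add_swap _ _ _ (p.injective.ne hab) (p.injective.ne hbc) (p.injective.ne hac)

theorem zero' (h : IsTripleOrientation t) (a b : Fin 6) : t a b a = 0 := by
  rw [h.rotate, h.zero]

theorem zero'' (h : IsTripleOrientation t) (a b : Fin 6) : t a b b = 0 := by
  rw [← h.rotate, h.zero]

theorem rotate_of_lt (h : IsTripleOrientation t) {a c : Fin 6} (b : Fin 6) (_ : c < a) :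
    t a b c = t c a b :=
  h.rotate _ _ _

theorem swap_of_lt (h : IsTripleOrientation t) {a b c : Fin 6} (hac : a < c) (hcb : c < b) :
    t a b c = 1 - t a c b := by
  have := h.add_swap a b c (hac.trans hcb).ne hcb.ne' hac.ne
  lia

theorem le_one (h : IsTripleOrientation t) (a b c : Fin 6) : t a b c ≤ 1 := by
  by_cases hab : a = b
  · subst hab
    rw [h.zero]
    lia
  by_cases hbc : b = c
  · subst hbc
    rw [h.zero'']
    lia
  by_cases hac : a = c
  · subst hac
    rw [h.zero']
    lia
  have := h.add_swap a b c hab hbc hac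
  lia

/-- The relation `t 0 u v = 1` is a tournament on 1, …, 5 with all out-degrees 2. The four given
arcs force the rotational one, in which each u beats the next two points of the cycle 1, 2, 3, 4, 5.
-/
theorem row_zero_of_sum_eq_two (h : IsTripleOrientation t) (hs : ∀ a b, a ≠ b → ∑ c, t a b c = 2)
    (h1 : t 0 1 2 = 1) (h2 : t 0 1 3 = 1) (h3 : t 0 2 3 = 1) (h4 : t 0 4 5 = 1) :
    t 0 1 4 = 0 ∧ t 0 1 5 = 0 ∧ t 0 2 4 = 1 ∧ t 0 2 5 = 0 ∧ t 0 3 4 = 1 ∧ t 0 3 5 = 1 := by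
  have e01 := hs 0 1 (by decide)
  have e02 := hs 0 2 (by decide)
  have e03 := hs 0 3 (by decide)
  have e04 := hs 0 4 (by decide)
  have e05 := hs 0 5 (by decide)
  simp only [Fin.sum_univ_six, h.zero', h.zero'', h.swap_of_lt,
    Fin.reduceLT] at e01 e02 e03 e04 e05
  have l012 := h.le_one 0 1 2
  have l013 := h.le_one 0 1 3
  have l014 := h.le_one 0 1 4
  have l015 := h.le_one 0 1 5
  have l023 := h.le_one 0 2 3
  have l024 := h.le_one 0 2 4
  have l025 := h.le_one 0 2 5
  have l034 := h.le_one 0 3 4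
  have l035 := h.le_one 0 3 5
  have l045 := h.le_one 0 4 5
  omega

theorem eq_dualOrder (h : IsTripleOrientation t) (hs : ∀ a b, a ≠ b → ∑ c, t a b c = 2)
    (h1 : t 0 1 2 = 1) (h2 : t 0 1 3 = 1) (h3 : t 0 2 3 = 1) (h4 : t 0 4 5 = 1)
    (h5 : t 1 2 4 = 1) (a : Fin 6 × Fin 6 × Fin 6) (ha : a ∈ tripleList) :
    t a.1 a.2.1 a.2.2 = if a ∈ dualOrderTriples then 1 else 0 := by
  obtain ⟨v014, v015, v024, v025, v034, v035⟩ :=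
    h.row_zero_of_sum_eq_two hs h1 h2 h3 h4
  have e12 := hs 1 2 (by decide)
  have e13 := hs 1 3 (by decide)
  have e14 := hs 1 4 (by decide)
  have e15 := hs 1 5 (by decide)
  have e23 := hs 2 3 (by decide)
  have e24 := hs 2 4 (by decide)
  have e25 := hs 2 5 (by decide)
  have e34 := hs 3 4 (by decide)
  have e35 := hs 3 5 (by decide)
  have e45 := hs 4 5 (by decide)
  simp only [Fin.sum_univ_six, h.zero', h.zero'', h.rotate_of_lt, h.swap_of_lt,
    Fin.reduceLT, h1, h2, h3, h4, h5, v014, v015, v024, v025, v034, v035]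
    at e12 e13 e14 e15 e23 e24 e25 e34 e35 e45
  have l123 := h.le_one 1 2 3
  have l124 := h.le_one 1 2 4
  have l125 := h.le_one 1 2 5
  have l134 := h.le_one 1 3 4
  have l135 := h.le_one 1 3 5
  have l145 := h.le_one 1 4 5
  have l234 := h.le_one 2 3 4
  have l235 := h.le_one 2 3 5
  have l245 := h.le_one 2 4 5
  have l345 := h.le_one 3 4 5
  have v123 : t 1 2 3 = 0 := by omega
  have v125 : t 1 2 5 = 0 := by omega
  have v134 : t 1 3 4 = 0 := by omega
  have v135 : t 1 3 5 = 0 := by omega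
  have v145 : t 1 4 5 = 1 := by omega
  have v234 : t 2 3 4 = 1 := by omega
  have v235 : t 2 3 5 = 0 := by omega
  have v245 : t 2 4 5 = 0 := by omega
  have v345 : t 3 4 5 = 0 := by omega
  fin_cases ha <;> simp [dualOrderTriples, h.swap_of_lt, *]

theorem exists_relabel_row (h : IsTripleOrientation t)
    (hs : ∀ a b, a ≠ b → ∑ c, t a b c = 2) :
    ∃ p : Perm (Fin 6), t (p 0) (p 1) (p 2) = 1 ∧ t (p 0) (p 1) (p 3) = 1 := by
  have e := hs 0 1 (by decide)
  simp only [Fin.sum_univ_six, h.zero', h.zero''] at e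
  have l2 := h.le_one 0 1 2
  have l3 := h.le_one 0 1 3
  have l4 := h.le_one 0 1 4
  have l5 := h.le_one 0 1 5
  by_cases h2 : t 0 1 2 = 1 <;> by_cases h3 : t 0 1 3 = 1
  · exact ⟨1, h2, h3⟩
  · by_cases h4 : t 0 1 4 = 1
    · exact ⟨swap 3 4, h2, h4⟩
    · exact ⟨swap 3 5, h2, show t 0 1 5 = 1 by lia⟩
  · by_cases h4 : t 0 1 4 = 1
    · exact ⟨swap 2 4, h4, h3⟩
    · exact ⟨swap 2 5, show t 0 1 5 = 1 by lia, h3⟩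
  · exact ⟨swap 2 4 * swap 3 5, show t 0 1 4 = 1 by lia, show t 0 1 5 = 1 by lia⟩

theorem sum_relabel (hs : ∀ a b, a ≠ b → ∑ c, t a b c = 2) (p : Perm (Fin 6)) (a b : Fin 6)
    (hab : a ≠ b) : ∑ c, t (p a) (p b) (p c) = 2 := by
  rw [Equiv.sum_comp p fun c => t (p a) (p b) c]
  exact hs _ _ (p.injective.ne hab)

/-- In the tournament at 0, the points beaten by 1 are named 2, 3 and the others 4, 5, in each pair
with the winner first. -/
theorem exists_relabel_rows (h : IsTripleOrientation t)
    (hs : ∀ a b, a ≠ b → ∑ c, t a b c = 2) :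
    ∃ p : Perm (Fin 6), t (p 0) (p 1) (p 2) = 1 ∧ t (p 0) (p 1) (p 3) = 1 ∧
      t (p 0) (p 2) (p 3) = 1 ∧ t (p 0) (p 4) (p 5) = 1 := by
  obtain ⟨p, h2, h3⟩ := h.exists_relabel_row hs
  have hp := h.relabel p
  have e23 := hp.add_swap 0 2 3 (by decide) (by decide) (by decide)
  have e45 := hp.add_swap 0 4 5 (by decide) (by decide) (by decide)
  by_cases h23 : t (p 0) (p 2) (p 3) = 1 <;> by_cases h45 : t (p 0) (p 4) (p 5) = 1
  · exact ⟨p, h2, h3, h23, h45⟩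
  · exact ⟨p * swap 4 5, h2, h3, h23, show t (p 0) (p 5) (p 4) = 1 by lia⟩
  · exact ⟨p * swap 2 3, h3, h2, show t (p 0) (p 3) (p 2) = 1 by lia, h45⟩
  · exact ⟨p * (swap 2 3 * swap 4 5), h3, h2, show t (p 0) (p 3) (p 2) = 1 by lia,
      show t (p 0) (p 5) (p 4) = 1 by lia⟩

theorem exists_relabel_dualOrder (h : IsTripleOrientation t)
    (hs : ∀ a b, a ≠ b → ∑ c, t a b c = 2) :
    ∃ p : Perm (Fin 6), ∀ a ∈ tripleList,
      t (p a.1) (p a.2.1) (p a.2.2) = if a ∈ dualOrderTriples then 1 else 0 := by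
  obtain ⟨p, h1, h2, h3, h4⟩ := h.exists_relabel_rows hs
  have hp := h.relabel p
  have hps := sum_relabel hs p
  have key : ∀ q : Perm (Fin 6), t (p (q 0)) (p (q 1)) (p (q 2)) = 1 →
      t (p (q 0)) (p (q 1)) (p (q 3)) = 1 → t (p (q 0)) (p (q 2)) (p (q 3)) = 1 →
      t (p (q 0)) (p (q 4)) (p (q 5)) = 1 → t (p (q 1)) (p (q 2)) (p (q 4)) = 1 →
      ∃ p : Perm (Fin 6), ∀ a ∈ tripleList,
        t (p a.1) (p a.2.1) (p a.2.2) = if a ∈ dualOrderTriples then 1 else 0 :=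
    fun q k1 k2 k3 k4 k5 => ⟨p * q, (hp.relabel q).eq_dualOrder (sum_relabel hs (p * q))
      k1 k2 k3 k4 k5⟩
  -- The rotation `r` preserves the tournament at 0 and moves the triple 124 through 235, 341, 452,
  -- 513. It suffices that one of these five is positive.
  obtain ⟨r, hr0, hr1, hr2, hr3, hr4, hr5⟩ : ∃ r : Perm (Fin 6),
      r 0 = 0 ∧ r 1 = 2 ∧ r 2 = 3 ∧ r 3 = 4 ∧ r 4 = 5 ∧ r 5 = 1 :=
    ⟨swap 1 2 * swap 2 3 * swap 3 4 * swap 4 5, by decide⟩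
  have k0 := key 1
  have k1 := key r
  have k2 := key (r * r)
  have k3 := key (r * r * r)
  have k4 := key (r * r * r * r)
  simp only [Perm.mul_apply, hr0, hr1, hr2, hr3, hr4, hr5, Perm.one_apply] at k0 k1 k2 k3 k4
  generalize hw : (fun a b c => t (p a) (p b) (p c)) = v at hp
  have hv : ∀ a b c, t (p a) (p b) (p c) = v a b c := fun a b c => by rw [← hw]
  simp only [hv] at h1 h2 h3 h4 hps k0 k1 k2 k3 k4
  obtain ⟨v014, v015, v024, v025, v034, v035⟩ :=
    hp.row_zero_of_sum_eq_two hps h1 h2 h3 h4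
  simp only [hp.rotate_of_lt, hp.swap_of_lt, Fin.reduceLT, h1, h2, h3, h4, v014, v015, v024, v025, v034, v035, true_implies,
    Nat.sub_zero] at k0 k1 k2 k3 k4
  by_contra hc
  have n0 : v 1 2 4 ≠ 1 := fun e => hc (k0 e)
  have n1 : v 2 3 5 ≠ 1 := fun e => hc (k1 e)
  have n2 : v 1 3 4 ≠ 1 := fun e => hc (k2 e)
  have n3 : v 2 4 5 ≠ 1 := fun e => hc (k3 e)
  have n4 : v 1 3 5 ≠ 1 := fun e => hc (k4 e)
  clear k0 k1 k2 k3 k4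
  have e12 := hps 1 2 (by decide)
  have e13 := hps 1 3 (by decide)
  have e14 := hps 1 4 (by decide)
  have e15 := hps 1 5 (by decide)
  have e23 := hps 2 3 (by decide)
  have e24 := hps 2 4 (by decide)
  have e25 := hps 2 5 (by decide)
  have e34 := hps 3 4 (by decide)
  have e35 := hps 3 5 (by decide)
  have e45 := hps 4 5 (by decide)
  simp only [Fin.sum_univ_six, hp.zero', hp.zero'', hp.rotate_of_lt, hp.swap_of_lt,
    Fin.reduceLT, h1, h2, h3, h4, v014, v015, v024, v025, v034, v035]
    at e12 e13 e14 e15 e23 e24 e25 e34 e35 e45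
  have l123 := hp.le_one 1 2 3
  have l124 := hp.le_one 1 2 4
  have l125 := hp.le_one 1 2 5
  have l134 := hp.le_one 1 3 4
  have l135 := hp.le_one 1 3 5
  have l145 := hp.le_one 1 4 5
  have l234 := hp.le_one 2 3 4
  have l235 := hp.le_one 2 3 5
  have l245 := hp.le_one 2 4 5
  have l345 := hp.le_one 3 4 5
  omega

/-- The signed version of an orientation of the triples. -/
def sgn (t : Fin 6 → Fin 6 → Fin 6 → ℕ) (a b c : Fin 6) : ℤ := t a b c - t a c b

/-- The cocycle identity says that the orientation is a cyclic order; cutting it at 0 gives a linear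
order, whose ranks are the new labels. -/
theorem exists_relabel_cyclicOrder (h : IsTripleOrientation t)
    (hs : ∀ a b c, sgn t a b c = sgn t 0 a b + sgn t 0 b c + sgn t 0 c a) :
    ∃ p : Perm (Fin 6), ∀ a ∈ tripleList,
      t (p a.1) (p a.2.1) (p a.2.2) = if a ∈ cyclicOrderTriples then 1 else 0 := by
  have ne_of : ∀ {a b c}, t a b c = 1 → a ≠ b ∧ b ≠ c ∧ a ≠ c := by
    intro a b c habc
    refine ⟨?_, ?_, ?_⟩ <;> rintro rfl
    · simp [h.zero] at habc
    · simp [h.zero''] at habc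
    · simp [h.zero'] at habc
  have sgn_one : ∀ {a b c}, t a b c = 1 → sgn t a b c = 1 := by
    intro a b c habc
    obtain ⟨h1, h2, h3⟩ := ne_of habc
    have := h.add_swap a b c h1 h2 h3
    unfold sgn
    lia
  have sgn_swap : ∀ a b c, sgn t a c b = - sgn t a b c := fun a b c => by
    unfold sgn
    ring
  have sgn_le : ∀ a b c, sgn t a b c ≤ 1 := fun a b c => by
    have := h.le_one a b c
    unfold sgn
    lia
  let lt : Fin 6 → Fin 6 → Prop := fun u v => (u = 0 ∧ v ≠ 0) ∨ t 0 u v = 1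
  have lt_irrefl : ∀ u, ¬ lt u u := by
    rintro u (⟨h1, h2⟩ | h1)
    · exact h2 h1
    · exact (ne_of h1).2.1 rfl
  have lt_total : ∀ u v, u ≠ v → lt u v ∨ lt v u := by
    intro u v huv
    by_cases hu : u = 0
    · exact Or.inl (Or.inl ⟨hu, fun hv => huv (hu.trans hv.symm)⟩)
    by_cases hv : v = 0
    · exact Or.inr (Or.inl ⟨hv, hu⟩)
    have := h.add_swap 0 u v (Ne.symm hu) huv (Ne.symm hv)
    by_cases h1 : t 0 u v = 1
    · exact Or.inl (Or.inr h1)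
    · exact Or.inr (Or.inr (by lia))
  have lt_trans : ∀ u v w, lt u v → lt v w → lt u w := by
    rintro u v w (⟨h1, h2⟩ | h1) (⟨h3, h4⟩ | h3)
    · exact absurd h3 h2
    · exact Or.inl ⟨h1, (ne_of h3).2.2.symm⟩
    · exact absurd h3 (ne_of h1).2.2.symm
    · have hu := (ne_of h1).1
      have hw := (ne_of h3).2.2
      have huw : u ≠ w := by
        rintro rfl
        have h5 := sgn_one h1
        have h6 := sgn_one h3
        rw [sgn_swap] at h6
        lia
      -- The cocycle identity reads sgn(u,v,w) = 1 + 1 + sgn(0,w,u), and the left side is at most 1,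
      -- so sgn(0,w,u) must be negative.
      refine Or.inr ?_
      have h5 := hs u v w
      have h6 := sgn_le u v w
      rw [sgn_one h1, sgn_one h3] at h5
      have h7 := h.add_swap 0 u w hu huw hw
      unfold sgn at h5 h6
      lia
  classical
  let r : Fin 6 → ℕ := fun v => (Finset.univ.filter fun u => lt u v).card
  have r_lt : ∀ v, r v < 6 := by
    intro v
    have : (Finset.univ.filter fun u => lt u v) ⊂ Finset.univ := by
      refine Finset.filter_ssubset.2 ⟨v, Finset.mem_univ v, lt_irrefl v⟩
    simpa using Finset.card_lt_card this
  have r_mono : ∀ u v, lt u v → r u < r v := by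
    intro u v huv
    refine Finset.card_lt_card ⟨fun w hw => ?_, fun hsub => ?_⟩
    · rw [Finset.mem_filter] at hw ⊢
      exact ⟨hw.1, lt_trans _ _ _ hw.2 huv⟩
    · have := hsub (Finset.mem_filter.2 ⟨Finset.mem_univ u, huv⟩)
      exact lt_irrefl u (Finset.mem_filter.1 this).2
  let q : Fin 6 → Fin 6 := fun v => ⟨r v, r_lt v⟩
  have q_inj : Function.Injective q := by
    intro u v huv
    by_contra hne
    have he : r u = r v := congrArg Fin.val huv
    rcases lt_total u v hne with h1 | h1
    · exact (r_mono _ _ h1).ne he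
    · exact (r_mono _ _ h1).ne' he
  let e : Perm (Fin 6) := Equiv.ofBijective q (Finite.injective_iff_bijective.1 q_inj)
  have lt_symm : ∀ i j, i < j → lt (e.symm i) (e.symm j) := by
    intro i j hij
    refine (lt_total _ _ (e.symm.injective.ne hij.ne)).resolve_right fun h1 => ?_
    have h2 : e (e.symm j) < e (e.symm i) := r_mono _ _ h1
    rw [e.apply_symm_apply, e.apply_symm_apply] at h2
    exact h2.not_gt hij
  have key : ∀ a b c, a < b → b < c → t (e.symm a) (e.symm b) (e.symm c) = 1 := by
    intro a b c hab hbc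
    rcases lt_symm a b hab with ⟨h1, h2⟩ | h1
    · rw [h1]
      exact (lt_symm b c hbc).resolve_left fun h3 => h2 h3.1
    · have h2 := (lt_symm b c hbc).resolve_left fun h3 => (ne_of h1).2.2 h3.1.symm
      have h3 := (lt_symm a c (hab.trans hbc)).resolve_left fun h3 => (ne_of h1).1 h3.1.symm
      have h4 := hs (e.symm a) (e.symm b) (e.symm c)
      rw [sgn_one h1, sgn_one h2, sgn_swap 0 (e.symm a) (e.symm c), sgn_one h3] at h4
      have h5 := h.le_one (e.symm a) (e.symm b) (e.symm c)
      unfold sgn at h4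
      lia
  refine ⟨e.symm, fun a ha => ?_⟩
  have hl : ∀ a ∈ tripleList, (a ∈ cyclicOrderTriples ↔ a.2.1 < a.2.2) ∧ a.1 < a.2.1 ∧
    a.1 < a.2.2 ∧ a.2.1 ≠ a.2.2 := by decide +kernel
  obtain ⟨h1, h2, h3, h4⟩ := hl a ha
  rw [if_congr h1 rfl rfl]
  split_ifs with h5
  · exact key _ _ _ h2 h5
  · have h6 := key _ _ _ h3 (lt_of_le_of_ne (not_lt.1 h5) h4.symm)
    have h7 := h.add_swap _ _ _ (ne_of h6).1 (ne_of h6).2.1 (ne_of h6).2.2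
    lia

end IsTripleOrientation

/-! ### Excluding designs and orientations -/

theorem eq_indicator_of_triples {X : Perm (Fin 6) → ℕ} (hX : ∀ x, movedCount x ≠ 3 → X x = 0)
    {T : List (Fin 6 × Fin 6 × Fin 6)} (hT : T ⊆ tripleList)
    (h : ∀ a ∈ tripleList, X (triCycle a.1 a.2.1 a.2.2) = if a ∈ T then 1 else 0)
    (x : Perm (Fin 6)) :
    X x = if x ∈ T.map (fun a => triCycle a.1 a.2.1 a.2.2) then 1 else 0 := by
  by_cases hx : movedCount x = 3
  · obtain ⟨a, ha, rfl⟩ := List.mem_map.1 (mem_threeCycleList.2 hx)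
    rw [h a ha]
    have : a ∈ T ↔ triCycle a.1 a.2.1 a.2.2 ∈ T.map (fun a => triCycle a.1 a.2.1 a.2.2) := by
      refine ⟨fun haT => List.mem_map.2 ⟨a, haT, rfl⟩, fun haT => ?_⟩
      obtain ⟨b, hb, hba⟩ := List.mem_map.1 haT
      exact List.inj_on_of_nodup_map nodup_threeCycleList (hT hb) ha hba ▸ hb
    rw [if_congr this rfl rfl]
  · rw [hX x hx, if_neg]
    intro hxT
    obtain ⟨b, hb, rfl⟩ := List.mem_map.1 hxT
    exact hx (mem_threeCycleList.1 (List.mem_map.2 ⟨b, hT hb, rfl⟩))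

theorem triCycle_apply_rotate {X : Perm (Fin 6) → ℕ} (hX : ∀ x, movedCount x ≠ 3 → X x = 0)
    (a b c : Fin 6) : X (triCycle b c a) = X (triCycle a b c) := by
  by_cases h : a ≠ b ∧ b ≠ c ∧ a ≠ c
  · rw [triCycle_rotate a b c h.1 h.2.1 h.2.2]
  · rw [hX _ ((movedCount_triCycle_eq_three_iff a b c).not.2 h), hX]
    rw [Ne, movedCount_triCycle_eq_three_iff]
    tauto

theorem triCycle_apply_zero {X : Perm (Fin 6) → ℕ} (hX : ∀ x, movedCount x ≠ 3 → X x = 0)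
    (a b : Fin 6) : X (triCycle a a b) = 0 :=
  hX _ (by simp [movedCount_triCycle_eq_three_iff])

namespace IsCommSchurFamily

variable {M : (Perm (Fin 6) → ℕ) → Prop} {X : Perm (Fin 6) → ℕ}

theorem exists_relabel (hM : IsCommSchurFamily M) {k : ℕ} (hk : M (movedInd k)) (hMX : M X)
    (hX : ∀ x, movedCount x ≠ 3 → X x = 0) (p : Perm (Fin 6))
    {T : List (Fin 6 × Fin 6 × Fin 6)} (hT : T ⊆ tripleList)
    (h : ∀ a ∈ tripleList, X (triCycle (p a.1) (p a.2.1) (p a.2.2)) = if a ∈ T then 1 else 0) :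
    ∃ (M' : (Perm (Fin 6) → ℕ) → Prop) (X' : Perm (Fin 6) → ℕ), IsCommSchurFamily M' ∧
      M' (movedInd k) ∧ M' X' ∧
      ∀ x, X' x = if x ∈ T.map (fun a => triCycle a.1 a.2.1 a.2.2) then 1 else 0 := by
  refine ⟨_, fun x => X (p * x * p⁻¹), hM.conj p, ?_, ?_, ?_⟩
  · have : (fun x => movedInd k (p⁻¹ * x * p)) = movedInd k := by
      funext x
      have := movedCount_conj p⁻¹ x
      rw [inv_inv] at this
      rw [movedInd, movedInd, this]
    rwa [this]
  · simpa [mul_assoc] using hMX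
  · refine eq_indicator_of_triples (fun x hx => hX _ (by rwa [movedCount_conj])) hT fun a ha => ?_
    rw [triCycle_conj]
    exact h a ha

theorem not_isTripleDesign (hM : IsCommSchurFamily M) (h2 : M (movedInd 2)) (hMX : M X)
    (hX : ∀ x, movedCount x ≠ 3 → X x = 0) :
    ¬ IsTripleDesign (fun a b c => X (triCycle a b c)) 2 := by
  intro h
  obtain ⟨p, hp⟩ := h.exists_relabel
  obtain ⟨M', X', hM', h2', hX', h'⟩ := hM.exists_relabel h2 hMX hX p (by decide +kernel) hp
  exact hM'.not_pentagon h2' hX' h'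

/-- A function in the family that is `1` on exactly one of each pair of mutually inverse `3`-cycles
cannot have constant convolution with the set of all `3`-cycles on the set where it is `1`. -/
theorem not_isTripleOrientation (hM : IsCommSchurFamily M) (h3 : M (movedInd 3)) (hMX : M X)
    (hX : ∀ x, movedCount x ≠ 3 → X x = 0)
    (h : IsTripleOrientation (fun a b c => X (triCycle a b c))) (k : ℕ)
    (hk : ∀ x, X x = 1 → groupConv X (movedInd 3) x = k) : False := by
  generalize ht : (fun a b c => X (triCycle a b c)) = t at h
  have htX : ∀ a b c, X (triCycle a b c) = t a b c := fun a b c => by rw [← ht]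
  let N : Fin 6 → Fin 6 → ℤ := fun a b => ∑ c, IsTripleOrientation.sgn t a b c
  have sgn_swap : ∀ a b c, IsTripleOrientation.sgn t a c b = -IsTripleOrientation.sgn t a b c :=
    fun a b c => by
      unfold IsTripleOrientation.sgn
      ring
  have sgn_rotate : ∀ a b c, IsTripleOrientation.sgn t b c a = IsTripleOrientation.sgn t a b c :=
    fun a b c => by
      unfold IsTripleOrientation.sgn
      rw [h.rotate a b c, h.rotate c b a, h.rotate a c b]
  have sgn_zero : ∀ a b, IsTripleOrientation.sgn t a a b = 0 := fun a b => by
    unfold IsTripleOrientation.sgn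
    rw [h.zero, h.zero']
    rfl
  have N_swap : ∀ a b, N b a = - N a b := fun a b => by
    simp only [N, ← Finset.sum_neg_distrib]
    refine Finset.sum_congr rfl fun c _ => ?_
    rw [← sgn_rotate b a c]
    exact sgn_swap a b c
  -- Of the four triples on a, b, the positive and negative ones add up to 4 and differ by N(a,b).
  have sum_t : ∀ a b, a ≠ b → 2 * (∑ c, (t a b c : ℤ)) = 4 + N a b := by
    intro a b hab
    have h1 : ∀ c, 2 * (t a b c : ℤ) = (if c = a ∨ c = b then 0 else 1) +
        IsTripleOrientation.sgn t a b c := by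
      intro c
      unfold IsTripleOrientation.sgn
      split_ifs with hc
      · rcases hc with rfl | rfl
        · rw [h.zero', h.zero]
          rfl
        · rw [h.zero'']
          rfl
      · rw [not_or] at hc
        have := h.add_swap a b c hab (Ne.symm hc.2) (Ne.symm hc.1)
        lia
    have h2 : ∀ a b : Fin 6, a ≠ b → (∑ c, if c = a ∨ c = b then (0 : ℤ) else 1) = 4 := by
      decide +kernel
    rw [Finset.mul_sum, Finset.sum_congr rfl fun c _ => h1 c, Finset.sum_add_distrib, h2 a b hab]
  have hN1 : ∀ a b c, t a b c = 1 → N a b + N b c + N c a = 2 * k - 6 := by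
    intro a b c habc
    have hd : a ≠ b ∧ b ≠ c ∧ a ≠ c := by
      rw [← movedCount_triCycle_eq_three_iff]
      by_contra hc
      have := hX _ hc
      rw [htX, habc] at this
      cases this
    obtain ⟨hab, hbc, hac⟩ := hd
    have e := groupConv_movedInd_triCycle hX hab hbc hac
    rw [hk _ ((htX a b c).trans habc)] at e
    simp only [htX, habc, Finset.sum_add_distrib] at e
    have e1 := sum_t a b hab
    have e2 := sum_t b c hbc
    have e3 := sum_t c a hac.symm
    have e4 := h.add_swap a b c hab hbc hac
    have e' : (k : ℤ) + 3 * 1 = t a c b + (∑ d, (t a b d : ℤ) + ∑ d, (t b c d : ℤ) +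
      ∑ d, (t c a d : ℤ)) := by exact_mod_cast e
    lia
  -- Both sides are alternating in a, b, c, so the positive triples suffice.
  have hN : ∀ a b c, N a b + N b c + N c a = (2 * k - 6) * IsTripleOrientation.sgn t a b c := by
    intro a b c
    by_cases hab : a = b
    · subst hab
      have := N_swap a a
      have := N_swap a c
      rw [sgn_zero]
      lia
    by_cases hbc : b = c
    · subst hbc
      have := N_swap b b
      have := N_swap a b
      rw [← sgn_rotate, sgn_zero]
      lia
    by_cases hac : a = c
    · subst hac
      have := N_swap a a
      have := N_swap a b
      rw [sgn_swap, sgn_zero]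
      lia
    have h1 := h.add_swap a b c hab hbc hac
    by_cases h2 : t a b c = 1
    · have h3 : t a c b = 0 := by lia
      rw [hN1 a b c h2, IsTripleOrientation.sgn, h2, h3]
      ring
    · have h3 : t a c b = 1 := by lia
      have h4 : t a b c = 0 := by lia
      have h5 := hN1 a c b h3
      have := N_swap a b
      have := N_swap b c
      have := N_swap a c
      rw [IsTripleOrientation.sgn, h3, h4]
      push_cast
      linarith
  -- This is a double sum of a function antisymmetric in b and c.
  have sumN : ∀ a, ∑ b, N a b = 0 := by
    intro a
    have h1 : ∑ b, N a b = -∑ b, N a b := by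
      conv_lhs => rw [show ∑ b, N a b = ∑ b, ∑ c, IsTripleOrientation.sgn t a b c from rfl,
        Finset.sum_comm]
      rw [← Finset.sum_neg_distrib]
      refine Finset.sum_congr rfl fun b _ => ?_
      simp only [N, ← Finset.sum_neg_distrib]
      exact Finset.sum_congr rfl fun c _ => sgn_swap a b c
    linarith
  -- Sum `hN` over the six values of c; the terms N(b,c) and N(c,a) cancel out by `sumN`.
  have hmul : ∀ a b, 6 * N a b = (2 * k - 6) * N a b := by
    intro a b
    have e : ∑ c, (N a b + N b c + N c a) =
        ∑ c, (2 * (k : ℤ) - 6) * IsTripleOrientation.sgn t a b c :=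
      Finset.sum_congr rfl fun c _ => hN a b c
    rw [Finset.sum_add_distrib, Finset.sum_add_distrib, sumN, ← Finset.mul_sum] at e
    have e' : ∑ c, N c a = 0 := by
      rw [Finset.sum_congr rfl fun c _ => N_swap a c, Finset.sum_neg_distrib, sumN, neg_zero]
    rw [e'] at e
    simpa only [Finset.sum_const, Finset.card_univ, Fintype.card_fin, nsmul_eq_mul, Nat.cast_ofNat,
      add_zero] using e
  -- If the factor is 6, then 6 sgn is the coboundary of N, so sgn is a cocycle. Otherwise N
  -- vanishes.
  by_cases hk6 : (2 * (k : ℤ) - 6) = 6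
  · obtain ⟨p, hp⟩ := h.exists_relabel_cyclicOrder fun a b c => by
      have e1 := hN a b c
      have e2 := hN 0 a b
      have e3 := hN 0 b c
      have e4 := hN 0 c a
      rw [hk6] at e1 e2 e3 e4
      have := N_swap 0 a
      have := N_swap 0 b
      have := N_swap 0 c
      lia
    simp only [← htX] at hp
    obtain ⟨M', X', hM', h3', hX', h'⟩ := hM.exists_relabel h3 hMX hX p (by decide +kernel) hp
    exact hM'.not_cyclicOrder h3' hX' h'
  · obtain ⟨p, hp⟩ := h.exists_relabel_dualOrder fun a b hab => by
      have e1 : (6 - (2 * (k : ℤ) - 6)) * N a b = 0 := by linarith [hmul a b]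
      have e2 : N a b = 0 := (mul_eq_zero.1 e1).resolve_left fun h0 => hk6 (by linarith)
      have e3 := sum_t a b hab
      have e4 : ((∑ c, t a b c : ℕ) : ℤ) = 2 := by
        push_cast
        linarith
      exact_mod_cast e4
    simp only [← htX] at hp
    obtain ⟨M', X', hM', h3', hX', h'⟩ := hM.exists_relabel h3 hMX hX p (by decide +kernel) hp
    exact hM'.not_dualOrder h3' hX' h'

end IsCommSchurFamily

/-! ### The principal set containing a 3-cycle -/

theorem mainTheorem4 (S : SchurRing (Equiv.Perm (Fin 6)))
    (hcomm : S.IsCommutative)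
    (htransp : S.IsPrincipalSet {σ : Equiv.Perm (Fin 6) | σ.IsSwap}) :
    S.IsPrincipalSet {σ : Equiv.Perm (Fin 6) | σ.IsThreeCycle} := by
  have hM := S.isCommSchurFamily hcomm
  obtain ⟨C, hC, hCswap⟩ := htransp
  have memC : ∀ x, x ∈ C ↔ x.IsSwap := fun x => by
    rw [← Finset.mem_coe, hCswap, Set.mem_ofPred_eq]
  have h2 : S.IsMeasurable (movedInd 2) := by
    have := S.isMeasurable_indicator hC
    have e : (fun x => if x ∈ C then 1 else 0) = movedInd 2 := by
      funext x
      rw [movedInd, if_congr ((memC x).trans movedCount_eq_two_iff.symm) rfl rfl]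
    rwa [e] at this
  have h3 : S.IsMeasurable (movedInd 3) := by
    have := hM.level 3 (hM.conv _ _ h2 h2)
    have e : (fun x => if groupConv (movedInd 2) (movedInd 2) x = 3 then 1 else 0) =
        movedInd 3 := by
      funext x
      rw [movedInd, if_congr (groupConv_movedInd_two_eq_three_iff x) rfl rfl]
    rwa [e] at this
  obtain ⟨A, hA, h0A⟩ := S.partition.exists_mem (Finset.mem_univ (triCycle 0 1 2))
  have hA3 : ∀ x ∈ A, movedCount x = 3 := by
    intro x hx
    have := h3 A hA x hx _ h0A
    have h0 : movedCount (triCycle 0 1 2) = 3 := by decide +kernel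
    rw [movedInd, movedInd, if_pos h0] at this
    by_contra hc
    rw [if_neg hc] at this
    cases this
  refine ⟨A, hA, Set.ext fun y => ⟨fun hy => movedCount_eq_three_iff.1 (hA3 y hy), fun hy => ?_⟩⟩
  obtain ⟨a, b, c, hab, hbc, hac, rfl⟩ := exists_eq_triCycle (movedCount_eq_three_iff.2 hy)
  rw [Finset.mem_coe]
  by_contra hyA
  let B : Finset (Perm (Fin 6)) := A.image fun g => g⁻¹
  have hB : B ∈ S.partition.parts := S.inv_mem A hA
  have memB : ∀ x, x ∈ B ↔ x⁻¹ ∈ A := fun x => by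
    simp only [B, Finset.mem_image]
    exact ⟨fun ⟨g, hg, hgx⟩ => by rwa [← hgx, inv_inv], fun h => ⟨_, h, inv_inv x⟩⟩
  let X : Perm (Fin 6) → ℕ := fun x => if x ∈ A then 1 else 0
  let W : Perm (Fin 6) → ℕ := fun x => if x ∈ A ∨ x ∈ B then 1 else 0
  have hMX : S.IsMeasurable X := S.isMeasurable_indicator hA
  have hMW : S.IsMeasurable W := by
    have := hM.comp₂ (fun m n => if m = 1 ∨ n = 1 then 1 else 0) _ _ hMX
      (S.isMeasurable_indicator hB)
    have e : (fun x => if X x = 1 ∨ (if x ∈ B then 1 else 0) = 1 then 1 else 0) = W := by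
      funext x
      simp [X, W]
    rwa [e] at this
  have hX : ∀ x, movedCount x ≠ 3 → X x = 0 := fun x hx => if_neg fun h => hx (hA3 x h)
  have hW : ∀ x, movedCount x ≠ 3 → W x = 0 := fun x hx => if_neg fun h => by
    rcases h with h | h
    · exact hx (hA3 x h)
    · have := hA3 _ ((memB x).1 h)
      rw [movedCount_eq_card_support, support_inv, ← movedCount_eq_card_support] at this
      exact hx this
  have hW_inv : ∀ x, W x⁻¹ = W x := fun x => by
    simp only [W, memB, inv_inv]
    rw [if_congr or_comm rfl rfl]
  have hW_swap : ∀ a b c, W (triCycle a c b) = W (triCycle a b c) := by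
    intro a b c
    by_cases h : a ≠ b ∧ b ≠ c ∧ a ≠ c
    · rw [← triCycle_inv a b c h.1 h.2.1 h.2.2, hW_inv]
    · rw [hW _ ((movedCount_triCycle_eq_three_iff a b c).not.2 h), hW]
      rw [Ne, movedCount_triCycle_eq_three_iff]
      tauto
  have hW_rotate := triCycle_apply_rotate hW
  -- The convolution of `W` with the transpositions is constant on the principal set of
  -- transpositions. Its value is twice the sum, because `W` counts both orientations of each
  -- triple.
  obtain ⟨k, hk⟩ : ∃ k, ∀ a b : Fin 6, a ≠ b → ∑ d, W (triCycle a b d) = k := by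
    refine ⟨∑ d, W (triCycle 0 1 d), fun a b hab => ?_⟩
    have key : ∀ a b : Fin 6, a ≠ b →
        groupConv W (movedInd 2) (swap a b) = 2 * ∑ d, W (triCycle a b d) := by
      intro a b hab
      rw [groupConv_movedInd_swap hW hab, Finset.mul_sum]
      refine Finset.sum_congr rfl fun d _ => ?_
      rw [← hW_rotate b a d, hW_swap a b d]
      ring
    have h1 := hM.conv _ _ hMW h2 C hC _ ((memC _).2 ⟨a, b, hab, rfl⟩) _
      ((memC _).2 ⟨0, 1, by decide, rfl⟩)
    rw [key a b hab, key 0 1 (by decide)] at h1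
    lia
  have hdes : IsTripleDesign (fun a b c => W (triCycle a b c)) k :=
    { rotate := hW_rotate
      swap := hW_swap
      zero := triCycle_apply_zero hW
      le_one := fun a b c => by
        simp only [W]
        split_ifs <;> lia
      sum := hk }
  rcases hdes.eq_two_or (if_pos (Or.inl h0A)) with rfl | hall
  · exact hM.not_isTripleDesign h2 hMW hW hdes
  -- Principal sets that meet are equal, and `A = B` would put the missing 3-cycle into `A`.
  · have hne : ∀ x ∈ A, x ∉ B := by
      intro x hxA hxB
      have e : A = B := S.partition.eq_of_mem_parts hA hB hxA hxB
      have := hall a b c hab hbc hac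
      simp only [W, ← e, or_self, if_neg hyA] at this
      cases this
    refine hM.not_isTripleOrientation h3 hMX hX
      { rotate := triCycle_apply_rotate hX
        zero := triCycle_apply_zero hX
        add_swap := fun a b c hab hbc hac => ?_ } (groupConv X (movedInd 3) (triCycle 0 1 2))
      fun x hx => ?_
    · have h1 := hall a b c hab hbc hac
      have h2 : triCycle a b c ∈ B ↔ triCycle a c b ∈ A := by
        rw [memB, triCycle_inv a b c hab hbc hac]
      have h3 := hne (triCycle a b c)
      simp only [W, X, h2] at h1 h3 ⊢
      by_cases h4 : triCycle a b c ∈ A <;> by_cases h5 : triCycle a c b ∈ A <;> simp_all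
    · refine hM.conv _ _ hMX h3 A hA x ?_ _ h0A
      by_contra hc
      simp only [X, if_neg hc] at hx
      cases hx
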